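/- Let $(N,g_N)$ be a smooth Riemannian manifold without boundary (Hausdorff, $\sigma$-compact, not necessarily compact, complete or connected), $\mathbf E_N\to N$ a smooth hermitian vector bundle, and $\mathcal D_N$ an elliptic first-order differential operator on $\mathbf E_N$ which is symmetric for the $L^2$-inner product on $\Gamma_c^\infty(N,\mathbf E_N)$. Let $C_N\subset N$ be compact, let $B$ be a smooth manifold, $C_B\subset B$ a closed subset, and put $$M:=\big((N\setminus C_N)\times B\big)\cup\big(N\times(B\setminus C_B)\big)\subset N\times B ,\qquad M_b:=\{x\in N:(x,b)\in M\}\quad(b\in B).$$ Let $\mathbf E\to M$ be the pullback of $\mathbf E_N$ along the projection $M\to N$, and let $E_b:=L^2(M_b,\mathbf E_N|_{M_b})$. Let $\Gamma_0(B,E_\bullet)$ be the Hilbert $C_0(B)$-module obtained by completing $\Gamma_c^\infty(M,\mathbf E)$ in the norm $\|\psi\|=\sup_{b\in B}\|\psi(\cdot,b)\|_{L^2(M_b)}$, with the pointwise $C_0(B)$-action and the inner product $\langle\psi,\varphi\rangle(b)=\int_{M_b}\langle\psi(x,b),\varphi(x,b)\rangle\,d\mathrm{vol}_{g_N}(x)$.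 The operator $$(\mathcal D\psi)(x,b):=\big(\mathcal D_N\,\psi(\cdot,b)\big)(x),\qquad \psi\in\Gamma_c^\infty(M,\mathbf E),\ (x,b)\in M,$$ where $\psi(\cdot,b)$ is extended by zero to $N$, is a densely defined operator on $\Gamma_0(B,E_\bullet)$. Let $H^1_c(N)$ be the space of compactly supported functions $u\in L^2(N,\mathbb C)$ whose weak differential $du$ is square-integrable, with the norm $\|u\|_{H^1}^2=\int_N(|u|^2+|du|^2)\,d\mathrm{vol}_{g_N}$. Suppose that $C_c^\infty(N\setminus C_N)$ is dense in $H^1_c(N)$ for this norm. Then $\mathcal D$ is regular on $\Gamma_0(B,E_\bullet)$. That is, its closure $\overline{\mathcal D}$ is a closed, densely defined, $C_0(B)$-linear operator, its adjoint $\overline{\mathcal D}^*$ is densely defined, and $1+\overline{\mathcal D}^*\,\overline{\mathcal D}$ has dense range. -/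

import Mathlib

open Bundle Manifold MeasureTheory Topology Set
open scoped ContDiff ZeroAtInfty ComplexOrder

set_option linter.unusedSectionVars false

noncomputable section

section ChartPartition

variable (n : ℕ) (N : Type*) [TopologicalSpace N] [ChartedSpace (EuclideanSpace ℝ (Fin n)) N]
  [T2Space N] [SigmaCompactSpace N] [IsManifold (𝓡 n) ∞ N]

lemma exists_chartPartition : ∃ ρ : SmoothPartitionOfUnity N (𝓡 n) N univ,
    ρ.IsSubordinate (fun x ↦ (chartAt (EuclideanSpace ℝ (Fin n)) x).source) :=
  SmoothPartitionOfUnity.exists_isSubordinate_chartAt_source (𝓡 n) N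

/-- A smooth partition of unity subordinate to the charts. -/
def chartPartition : SmoothPartitionOfUnity N (𝓡 n) N univ :=
  (exists_chartPartition n N).choose

end ChartPartition

section Volume

variable {n : ℕ} {N : Type*} [TopologicalSpace N] [ChartedSpace (EuclideanSpace ℝ (Fin n)) N]
  [RiemannianBundle (fun x : N ↦ TangentSpace (𝓡 n) x)]

/-- The vector `v`, transported from the chart at `x₀` to the tangent space of the manifold. -/
def chartVector (x₀ : N) (y v : EuclideanSpace ℝ (Fin n)) :
    TangentSpace (𝓡 n) ((chartAt (EuclideanSpace ℝ (Fin n)) x₀).symm y) :=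
  mfderiv (𝓡 n) (𝓡 n) (chartAt (EuclideanSpace ℝ (Fin n)) x₀).symm y v

/-- The volume density `√det (g_ij)` of the Riemannian metric in the chart at `x₀`. -/
def chartDensity (x₀ : N) (y : EuclideanSpace ℝ (Fin n)) : ℝ :=
  √(Matrix.gram ℝ (fun i : Fin n ↦ chartVector x₀ y (EuclideanSpace.basisFun (Fin n) ℝ i))).det

variable [MeasurableSpace N]

variable (n) in
/-- The Riemannian volume of the domain of the chart at `x₀`, as a measure on the manifold. -/
def chartVolume (x₀ : N) : Measure N :=
  ((volume.restrict (chartAt (EuclideanSpace ℝ (Fin n)) x₀).target).withDensity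
    (fun y ↦ ENNReal.ofReal (chartDensity x₀ y))).map (chartAt (EuclideanSpace ℝ (Fin n)) x₀).symm

variable [T2Space N] [SigmaCompactSpace N] [IsManifold (𝓡 n) ∞ N]

variable (n N) in
/-- The Riemannian volume measure: `∫ f dvol = ∑ᵢ ∫ (ρᵢ f) ∘ φᵢ⁻¹ √det g dy` for a
partition of unity `ρ` subordinate to the charts `φᵢ` (the result does not depend on `ρ`). -/
def riemannianVolume : Measure N :=
  Measure.sum fun i : N ↦
    (chartVolume n i).withDensity (fun x ↦ ENNReal.ofReal (chartPartition n N i x))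

variable [BorelSpace N] [IsContMDiffRiemannianBundle (𝓡 n) ∞ (EuclideanSpace ℝ (Fin n))
    (fun x : N ↦ TangentSpace (𝓡 n) x)]

lemma continuousOn_chartDensity (x₀ : N) :
    ContinuousOn (chartDensity x₀) (chartAt (EuclideanSpace ℝ (Fin n)) x₀).target := by
  have key : ∀ v, ContinuousOn (fun y ↦ (⟨_, chartVector x₀ y v⟩ : TangentBundle (𝓡 n) N))
      (chartAt (EuclideanSpace ℝ (Fin n)) x₀).target := by
    intro v
    have h1 : ContMDiffOn (𝓡 n) (𝓡 n) 1 (chartAt (EuclideanSpace ℝ (Fin n)) x₀).symm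
      (chartAt (EuclideanSpace ℝ (Fin n)) x₀).target :=
        (contMDiffOn_chart_symm (I := 𝓡 n) (n := ∞)).of_le (by simp)
    have h2 := h1.continuousOn_tangentMapWithin le_rfl
      (chartAt (EuclideanSpace ℝ (Fin n)) x₀).open_target.uniqueMDiffOn
    have h3 : Continuous (fun y : EuclideanSpace ℝ (Fin n) ↦
        ((tangentBundleModelSpaceHomeomorph (𝓡 n)).symm (y, v) :
          TangentBundle (𝓡 n) (EuclideanSpace ℝ (Fin n)))) := by
      fun_prop
    refine (h2.comp h3.continuousOn (s := (chartAt (EuclideanSpace ℝ (Fin n)) x₀).target)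
      (fun y hy ↦ hy)).congr fun y hy ↦ ?_
    simp only [chartVector, tangentMapWithin, Function.comp]
    rw [mfderivWithin_of_isOpen (chartAt (EuclideanSpace ℝ (Fin n)) x₀).open_target]
    · rfl
    · exact hy
  have : IsContinuousRiemannianBundle (EuclideanSpace ℝ (Fin n))
      (fun x : N ↦ TangentSpace (𝓡 n) x) := by
    obtain ⟨g, hg, hg'⟩ := IsContMDiffRiemannianBundle.exists_contMDiff (IB := 𝓡 n) (n := ∞)
      (F := EuclideanSpace ℝ (Fin n)) (E := fun x : N ↦ TangentSpace (𝓡 n) x)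
    exact ⟨g, hg.continuous, hg'⟩
  unfold chartDensity
  refine Real.continuous_sqrt.comp_continuousOn ?_
  refine (Continuous.matrix_det continuous_id).comp_continuousOn ?_
  refine continuousOn_pi.2 fun i ↦ continuousOn_pi.2 fun j ↦ ?_
  exact ContinuousOn.inner_bundle (F := EuclideanSpace ℝ (Fin n))
    (E := (fun x : N ↦ TangentSpace (𝓡 n) x)) (key _) (key _)

lemma chartDensity_pos (x₀ : N) {y : EuclideanSpace ℝ (Fin n)}
    (hy : y ∈ (chartAt (EuclideanSpace ℝ (Fin n)) x₀).target) : 0 < chartDensity x₀ y := by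
  refine Real.sqrt_pos.2 (Matrix.PosDef.det_pos (Matrix.posDef_gram_of_linearIndependent ?_))
  have h := ((mdifferentiable_chart (I := 𝓡 n) x₀).symm).mfderiv_injective hy
  exact (EuclideanSpace.basisFun (Fin n) ℝ).toBasis.linearIndependent.map'
    (mfderiv (𝓡 n) (𝓡 n) (chartAt (EuclideanSpace ℝ (Fin n)) x₀).symm y).toLinearMap
    (LinearMap.ker_eq_bot.2 h)

lemma aemeasurable_chart_symm (x₀ : N) (f : EuclideanSpace ℝ (Fin n) → ENNReal) :
    AEMeasurable (chartAt (EuclideanSpace ℝ (Fin n)) x₀).symm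
      ((volume.restrict (chartAt (EuclideanSpace ℝ (Fin n)) x₀).target).withDensity f) :=
  ((chartAt (EuclideanSpace ℝ (Fin n)) x₀).continuousOn_symm.aemeasurable
    (chartAt (EuclideanSpace ℝ (Fin n)) x₀).open_target.measurableSet).mono_ac
      (withDensity_absolutelyContinuous _ _)

lemma chartVolume_apply (x₀ : N) {s : Set N} (hs : MeasurableSet s) :
    chartVolume n x₀ s = ∫⁻ y in (chartAt (EuclideanSpace ℝ (Fin n)) x₀).symm ⁻¹' s ∩
      (chartAt (EuclideanSpace ℝ (Fin n)) x₀).target, ENNReal.ofReal (chartDensity x₀ y) := by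
  set φ := chartAt (EuclideanSpace ℝ (Fin n)) x₀
  have hm : NullMeasurableSet (φ.symm ⁻¹' s) (volume.restrict φ.target) :=
    (φ.continuousOn_symm.aemeasurable φ.open_target.measurableSet).nullMeasurable hs
  rw [chartVolume, Measure.map_apply_of_aemeasurable (aemeasurable_chart_symm _ _) hs,
    withDensity_apply₀ _ hm, Measure.restrict_restrict₀ hm]

variable (n N) in
instance isLocallyFiniteMeasure_riemannianVolume :
    IsLocallyFiniteMeasure (riemannianVolume n N) := by
  refine ⟨fun x ↦ ?_⟩
  obtain ⟨W, hW, hfin⟩ := (chartPartition n N).locallyFinite x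
  have hloc : ∀ i : N, ∃ U ∈ 𝓝 x, (chartVolume n i).withDensity
      (fun x ↦ ENNReal.ofReal (chartPartition n N i x)) U < ⊤ := by
    intro i
    by_cases hx : x ∈ tsupport (chartPartition n N i)
    · set φ := chartAt (EuclideanSpace ℝ (Fin n)) i with hφ
      have hxs : x ∈ φ.source := (exists_chartPartition n N).choose_spec i hx
      have hc := ((continuousOn_chartDensity i).continuousAt
        (φ.open_target.mem_nhds (φ.map_source hxs)))
      have h1 : {y | chartDensity i y < chartDensity i (φ x) + 1} ∈ 𝓝 (φ x) :=
        hc.eventually_lt continuousAt_const (by simp)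
      obtain ⟨r, hr, hr'⟩ := Metric.mem_nhds_iff.1 h1
      refine ⟨φ.source ∩ φ ⁻¹' (Metric.ball (φ x) r), ?_, ?_⟩
      · exact (φ.isOpen_inter_preimage Metric.isOpen_ball).mem_nhds ⟨hxs, by simpa using hr⟩
      · have hms : MeasurableSet (φ.source ∩ φ ⁻¹' (Metric.ball (φ x) r)) :=
          (φ.isOpen_inter_preimage Metric.isOpen_ball).measurableSet
        calc _ = ∫⁻ x in _, ENNReal.ofReal (chartPartition n N i x) ∂(chartVolume n i) :=
              withDensity_apply _ hms
          _ ≤ ∫⁻ x in (φ.source ∩ φ ⁻¹' (Metric.ball (φ x) r)), 1 ∂(chartVolume n i) := by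
              refine lintegral_mono fun z ↦ ?_
              simpa using (chartPartition n N).le_one i z
          _ = chartVolume n i (φ.source ∩ φ ⁻¹' (Metric.ball (φ x) r)) := by simp
          _ ≤ ∫⁻ y in Metric.ball (φ x) r, ENNReal.ofReal (chartDensity i (φ x) + 1) := by
              rw [chartVolume_apply i hms]
              refine (setLIntegral_mono_ae' ?_ ?_).trans (lintegral_mono_set ?_)
              · exact (φ.isOpen_inter_preimage_symm
                  (φ.isOpen_inter_preimage Metric.isOpen_ball)).measurableSet.congr
                    (by rw [inter_comm])
              · refine Filter.Eventually.of_forall fun y hy ↦ ENNReal.ofReal_le_ofReal ?_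
                have : φ (φ.symm y) ∈ Metric.ball (φ x) r := hy.1.2
                rw [φ.right_inv hy.2] at this
                exact (hr' this).le
              · intro y hy
                have : φ (φ.symm y) ∈ Metric.ball (φ x) r := hy.1.2
                rwa [φ.right_inv hy.2] at this
          _ < ⊤ := by
              simp [ENNReal.mul_lt_top_iff, measure_ball_lt_top]
    · refine ⟨(tsupport (chartPartition n N i))ᶜ,
        (isClosed_tsupport _).isOpen_compl.mem_nhds hx, ?_⟩
      rw [withDensity_apply _ (isClosed_tsupport _).measurableSet.compl,
        setLIntegral_congr_fun (g := fun _ ↦ 0)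
          (isClosed_tsupport _).measurableSet.compl ?_]
      · simp
      · intro z hz
        simp [image_eq_zero_of_notMem_tsupport hz]
  choose U hU hUfin using hloc
  set T : Set N := interior (W ∩ ⋂ i ∈ hfin.toFinset, U i) with hT
  have hTm : MeasurableSet T := isOpen_interior.measurableSet
  have hTs : T ⊆ W ∩ ⋂ i ∈ hfin.toFinset, U i := interior_subset
  refine ⟨T, interior_mem_nhds.2 (Filter.inter_mem hW
    ((Filter.biInter_finset_mem _).2 fun i _ ↦ hU i)), ?_⟩
  rw [riemannianVolume, Measure.sum_apply _ hTm, tsum_eq_sum (s := hfin.toFinset)]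
  · refine ENNReal.sum_lt_top.2 fun i hi ↦ (measure_mono ?_).trans_lt (hUfin i)
    exact fun z hz ↦ mem_iInter₂.1 (hTs hz).2 i hi
  · intro i hi
    rw [withDensity_apply _ hTm, setLIntegral_congr_fun (g := fun _ ↦ 0) hTm ?_]
    · simp
    · intro z hz
      have : chartPartition n N i z = 0 := by
        by_contra h
        exact hi (hfin.mem_toFinset.2 ⟨z, h, (hTs hz).1⟩)
      simp [this]

variable (n N) in
instance isOpenPosMeasure_riemannianVolume :
    Measure.IsOpenPosMeasure (riemannianVolume n N) := by
  refine ⟨fun U hU ⟨x, hx⟩ h0 ↦ ?_⟩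
  obtain ⟨i, hi⟩ := (chartPartition n N).exists_pos_of_mem (mem_univ x)
  set φ := chartAt (EuclideanSpace ℝ (Fin n)) i with hφ
  have hxs : x ∈ φ.source := (exists_chartPartition n N).choose_spec i (subset_tsupport _ hi.ne')
  rw [riemannianVolume, Measure.sum_apply _ hU.measurableSet, ENNReal.tsum_eq_zero] at h0
  have h1 := h0 i
  set U' : Set N := U ∩ {z | 0 < chartPartition n N i z}
  have hρ : Continuous (chartPartition n N i) := (chartPartition n N i).contMDiff.continuous
  have hU' : IsOpen U' := hU.inter (isOpen_lt continuous_const hρ)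
  have h2 : chartVolume n i U' = 0 := by
    rw [withDensity_apply _ hU.measurableSet,
      setLIntegral_eq_zero_iff hU.measurableSet (by fun_prop)] at h1
    refine measure_mono_null ?_ h1
    intro z hz h
    simpa [(show 0 < chartPartition n N i z from hz.2).not_ge] using h hz.1
  rw [chartVolume_apply i hU'.measurableSet] at h2
  have hO : IsOpen (φ.symm ⁻¹' U' ∩ φ.target) := by
    rw [inter_comm]; exact φ.isOpen_inter_preimage_symm hU'
  have h3 : AEMeasurable (fun y ↦ ENNReal.ofReal (chartDensity i y))
      (volume.restrict (φ.symm ⁻¹' U' ∩ φ.target)) :=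
    (((continuousOn_chartDensity i).mono inter_subset_right).aemeasurable
      hO.measurableSet).ennreal_ofReal
  rw [lintegral_eq_zero_iff' h3, Filter.EventuallyEq, ae_restrict_iff' hO.measurableSet] at h2
  have h4 : volume (φ.symm ⁻¹' U' ∩ φ.target) = 0 := by
    refine measure_mono_null ?_ h2
    intro y hy h
    simpa [(chartDensity_pos i hy.2).not_ge] using h hy
  refine (hO.measure_pos volume ⟨φ x, ?_, φ.map_source hxs⟩).ne' h4
  simpa [U', φ.left_inv hxs] using ⟨hx, hi⟩

end Volume

section Sections

variable {n : ℕ} {N : Type*} [TopologicalSpace N] [ChartedSpace (EuclideanSpace ℝ (Fin n)) N]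
  {F : Type*} [NormedAddCommGroup F] [NormedSpace ℂ F]
  [T2Space N] {V : N → Type*} [TopologicalSpace (TotalSpace F V)] [∀ x, NormedAddCommGroup (V x)]
  [∀ x, InnerProductSpace ℂ (V x)] [FiberBundle F V]

variable (n F V) in
/-- The hermitian inner products on the fibres of `V` depend smoothly on the base point. -/
class IsSmoothHermitianBundle [VectorBundle ℝ F V] : Prop where
  exists_contMDiff : ∃ g : ∀ x, V x →L[ℝ] V x →L[ℝ] ℂ,
    ContMDiff (𝓡 n) ((𝓡 n).prod 𝓘(ℝ, F →L[ℝ] F →L[ℝ] ℂ)) ∞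
      (fun x ↦ TotalSpace.mk' (F →L[ℝ] F →L[ℝ] ℂ) x (g x)) ∧
    ∀ (x : N) (v w : V x), inner ℂ v w = g x v w

section Along

variable {EX HX X : Type*} [NormedAddCommGroup EX] [NormedSpace ℝ EX] [TopologicalSpace HX]
  [TopologicalSpace X] [ChartedSpace HX X]

/-- The section `s` of the pullback of the bundle `V` along `f` is smooth at `x`. -/
def SmoothAlongAt (n : ℕ) [ChartedSpace (EuclideanSpace ℝ (Fin n)) N] (F : Type*) [NormedAddCommGroup F] [NormedSpace ℂ F]
    [TopologicalSpace (TotalSpace F V)] [FiberBundle F V]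
    (J : ModelWithCorners ℝ EX HX) (f : X → N) (s : ∀ x, V (f x)) (x : X) : Prop :=
  ContMDiffAt J ((𝓡 n).prod 𝓘(ℝ, F)) ∞ (fun z ↦ TotalSpace.mk' F (f z) (s z)) x

variable {J : ModelWithCorners ℝ EX HX} {f : X → N} {s t : ∀ x, V (f x)} {x : X}

lemma smoothAlongAt_iff : SmoothAlongAt n F J f s x ↔ ContMDiffAt J (𝓡 n) ∞ f x ∧
    ContMDiffAt J 𝓘(ℝ, F) ∞
      (fun z ↦ (trivializationAt F V (f x) (TotalSpace.mk' F (f z) (s z))).2) x :=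
  contMDiffAt_totalSpace

lemma SmoothAlongAt.base (hs : SmoothAlongAt n F J f s x) : ContMDiffAt J (𝓡 n) ∞ f x :=
  (smoothAlongAt_iff.1 hs).1

lemma SmoothAlongAt.congr (hs : SmoothAlongAt n F J f s x) (h : ∀ᶠ z in 𝓝 x, t z = s z) :
    SmoothAlongAt n F J f t x :=
  ContMDiffAt.congr_of_eventuallyEq hs (h.mono fun z hz ↦ by simp [hz])

lemma eventually_mem_baseSet (hf : ContMDiffAt J (𝓡 n) ∞ f x) :
    ∀ᶠ z in 𝓝 x, f z ∈ (trivializationAt F V (f x)).baseSet :=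
  hf.continuousAt.eventually_mem ((trivializationAt F V (f x)).open_baseSet.mem_nhds
    (FiberBundle.mem_baseSet_trivializationAt' (f x)))

variable [VectorBundle ℂ F V]

lemma SmoothAlongAt.add (hs : SmoothAlongAt n F J f s x) (ht : SmoothAlongAt n F J f t x) :
    SmoothAlongAt n F J f (fun z ↦ s z + t z) x := by
  rw [smoothAlongAt_iff] at hs ht ⊢
  refine ⟨hs.1, (hs.2.add ht.2).congr_of_eventuallyEq ?_⟩
  filter_upwards [eventually_mem_baseSet (n := n) (F := F) (V := V) hs.1] with z hz
  exact ((trivializationAt F V (f x)).linear ℂ hz).map_add _ _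

lemma SmoothAlongAt.smul {c : X → ℂ} (hc : ContMDiffAt J 𝓘(ℝ, ℂ) ∞ c x)
    (hs : SmoothAlongAt n F J f s x) : SmoothAlongAt n F J f (fun z ↦ c z • s z) x := by
  rw [smoothAlongAt_iff] at hs ⊢
  refine ⟨hs.1, (ContMDiffAt.clm_apply (𝕜 := ℝ) (F₁ := F) (F₂ := F) (g := fun z ↦ (ContinuousLinearMap.lsmul ℝ ℂ (c z))) ?_ hs.2).congr_of_eventuallyEq ?_⟩
  · exact (ContinuousLinearMap.lsmul ℝ ℂ : ℂ →L[ℝ] F →L[ℝ] F).contDiff.contMDiff.contMDiffAt.comp x hc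
  filter_upwards [eventually_mem_baseSet (n := n) (F := F) (V := V) hs.1] with z hz
  exact ((trivializationAt F V (f x)).linear ℂ hz).map_smul _ _

lemma SmoothAlongAt.zero (hf : ContMDiffAt J (𝓡 n) ∞ f x) :
    SmoothAlongAt n F J f (fun z ↦ (0 : V (f z))) x := by
  rw [smoothAlongAt_iff]
  refine ⟨hf, (contMDiffAt_const (c := (0 : F))).congr_of_eventuallyEq ?_⟩
  filter_upwards [eventually_mem_baseSet (n := n) (F := F) (V := V) hf] with z hz
  exact ((trivializationAt F V (f x)).linear ℂ hz).map_zero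


section Inner

variable [VectorBundle ℝ F V] [IsSmoothHermitianBundle n F V]

lemma SmoothAlongAt.continuousAt_inner (hs : SmoothAlongAt n F J f s x)
    (ht : SmoothAlongAt n F J f t x) : ContinuousAt (fun z ↦ inner ℂ (s z) (t z)) x := by
  obtain ⟨g, hg, hg'⟩ := IsSmoothHermitianBundle.exists_contMDiff (n := n) (F := F) (V := V)
  simp only [hg']
  have h : ContMDiffAt J ((𝓡 n).prod 𝓘(ℝ, ℂ)) ∞
      (fun z ↦ TotalSpace.mk' ℂ (E := Bundle.Trivial N ℂ) (f z) (g (f z) (s z) (t z))) x := by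
    apply ContMDiffAt.clm_bundle_apply₂ (F₁ := F) (F₂ := F)
    · exact ContMDiffAt.comp x hg.contMDiffAt hs.base
    · exact hs
    · exact ht
  simp only [contMDiffAt_totalSpace] at h
  exact h.2.continuousAt

end Inner

end Along

/-- The support of a section. -/
def sectionSupport {X : Type*} [TopologicalSpace X] {W : X → Type*} [∀ x, Zero (W x)]
    (s : ∀ x, W x) : Set X :=
  closure {x | s x ≠ 0}

section Support

variable {X : Type*} [TopologicalSpace X] {W : X → Type*} [∀ x, AddCommGroup (W x)]

lemma eq_zero_of_notMem_sectionSupport {s : ∀ x, W x} {x : X} (hx : x ∉ sectionSupport s) :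
    s x = 0 := by
  by_contra h
  exact hx (subset_closure h)

lemma sectionSupport_mono {W' : X → Type*} [∀ x, AddCommGroup (W' x)] {s : ∀ x, W x}
    {t : ∀ x, W' x} (h : ∀ x, t x = 0 → s x = 0) : sectionSupport s ⊆ sectionSupport t :=
  closure_mono fun _ hx h0 ↦ hx (h _ h0)

lemma sectionSupport_add (s t : ∀ x, W x) :
    sectionSupport (s + t) ⊆ sectionSupport s ∪ sectionSupport t := by
  rw [sectionSupport, sectionSupport, sectionSupport, ← closure_union]
  refine closure_mono fun x hx ↦ ?_
  by_contra h
  simp only [mem_union, mem_ofPred_eq, not_or, not_not] at h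
  exact hx (by simp [h.1, h.2])

lemma sectionSupport_zero : sectionSupport (0 : ∀ x, W x) = ∅ := by
  simp [sectionSupport]

end Support

variable [VectorBundle ℂ F V]

variable (n F V) in
/-- The smooth sections of the vector bundle `V` over `N`. -/
def SmoothSections : Submodule ℂ (∀ x, V x) where
  carrier := {s | ContMDiff (𝓡 n) ((𝓡 n).prod 𝓘(ℝ, F)) ∞ (fun x ↦ TotalSpace.mk' F x (s x))}
  add_mem' hs ht x := SmoothAlongAt.add (f := id) (hs x) (ht x)
  zero_mem' _ := SmoothAlongAt.zero (f := id) contMDiffAt_id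
  smul_mem' _ _ hs x := SmoothAlongAt.smul (f := id) contMDiffAt_const (hs x)

variable (n F V) in
/-- The smooth sections of `V` which are compactly supported in `U`. For open `U`, extension by
zero identifies them with the compactly supported smooth sections of the restriction of `V`
to `U`. -/
def compactSections (U : Set N) : Submodule ℂ (∀ x, V x) where
  carrier := {s | s ∈ SmoothSections n F V ∧ IsCompact (sectionSupport s) ∧ sectionSupport s ⊆ U}
  add_mem' := fun {s t} hs ht ↦ ⟨add_mem hs.1 ht.1,
    (hs.2.1.union ht.2.1).of_isClosed_subset isClosed_closure (sectionSupport_add s t),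
    (sectionSupport_add s t).trans (union_subset hs.2.2 ht.2.2)⟩
  zero_mem' := ⟨zero_mem _, by simp [sectionSupport_zero], by simp [sectionSupport_zero]⟩
  smul_mem' := fun c s hs ↦
    have h : sectionSupport (c • s) ⊆ sectionSupport s := sectionSupport_mono fun _ hx ↦ by simp [hx]
    ⟨Submodule.smul_mem _ c hs.1, hs.2.1.of_isClosed_subset isClosed_closure h, h.trans hs.2.2⟩

variable (n F V) in
/-- The space `Γ_c^∞(U, V)`, which will be equipped with the `L²` inner product. -/
def TestSections (U : Set N) : Type _ := compactSections n F V U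

instance (U : Set N) : AddCommGroup (TestSections n F V U) :=
  inferInstanceAs (AddCommGroup (compactSections n F V U))

instance (U : Set N) : Module ℂ (TestSections n F V U) :=
  inferInstanceAs (Module ℂ (compactSections n F V U))

variable {m : ℕ} {B : Type*} [TopologicalSpace B] [ChartedSpace (EuclideanSpace ℝ (Fin m)) B]

variable (n F V m B) in
/-- The smooth sections, compactly supported in `M`, of the pullback of `V` along the
projection `N × B → N`. For open `M`, extension by zero identifies them with the compactly
supported smooth sections over `M` of the pullback of `V` to `M`. -/
def totalSections (M : Set (N × B)) : Submodule ℂ (∀ p : N × B, V p.1) where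
  carrier := {s | ContMDiff ((𝓡 n).prod (𝓡 m)) ((𝓡 n).prod 𝓘(ℝ, F)) ∞
      (fun p : N × B ↦ TotalSpace.mk' F p.1 (s p)) ∧
    IsCompact (sectionSupport s) ∧ sectionSupport s ⊆ M}
  add_mem' := fun {s t} hs ht ↦
    ⟨fun x ↦ SmoothAlongAt.add (f := Prod.fst) (hs.1 x) (ht.1 x),
    (hs.2.1.union ht.2.1).of_isClosed_subset isClosed_closure (sectionSupport_add s t),
    (sectionSupport_add s t).trans (union_subset hs.2.2 ht.2.2)⟩
  zero_mem' := ⟨fun x ↦ SmoothAlongAt.zero (f := Prod.fst) contMDiffAt_fst,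
    by simp [sectionSupport_zero], by simp [sectionSupport_zero]⟩
  smul_mem' := fun c s hs ↦
    have h : sectionSupport (c • s) ⊆ sectionSupport s := sectionSupport_mono fun _ hx ↦ by simp [hx]
    ⟨fun x ↦ SmoothAlongAt.smul (f := Prod.fst) contMDiffAt_const (hs.1 x),
      hs.2.1.of_isClosed_subset isClosed_closure h, h.trans hs.2.2⟩

lemma sectionSupport_slice_subset {W : N → Type*} [∀ x, AddCommGroup (W x)]
    (ψ : ∀ p : N × B, W p.1) (b : B) :
    sectionSupport (fun x ↦ ψ (x, b)) ⊆ (fun x ↦ (x, b)) ⁻¹' sectionSupport ψ :=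
  closure_minimal (fun _ hx ↦ subset_closure hx) (isClosed_closure.preimage (by fun_prop))

/-- The fibre `M_b` of `M ⊆ N × B` over `b`. -/
abbrev fibre (M : Set (N × B)) (b : B) : Set N := (fun x ↦ (x, b)) ⁻¹' M

/-- The restriction `ψ(·, b)` of a section over `M` to the fibre `M_b`. -/
def slice (M : Set (N × B)) (b : B) : totalSections n F V m B M →ₗ[ℂ]
    TestSections n F V (fibre M b) where
  toFun ψ := ⟨fun x ↦ ψ.1 (x, b),
    ψ.2.1.comp (contMDiff_id.prodMk contMDiff_const), by
      have : IsCompact (Prod.fst '' sectionSupport ψ.1) := ψ.2.2.1.image continuous_fst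
      have h1 : IsCompact (closure (Prod.fst '' sectionSupport ψ.1)) := this.closure
      refine h1.of_isClosed_subset isClosed_closure
        ((sectionSupport_slice_subset ψ.1 b).trans (Subset.trans ?_ subset_closure))
      intro x hx
      exact ⟨(x, b), hx, rfl⟩,
    (sectionSupport_slice_subset ψ.1 b).trans (preimage_mono ψ.2.2.2)⟩
  map_add' _ _ := rfl
  map_smul' _ _ := rfl

end Sections

section Field

variable {B : Type*} [TopologicalSpace B]

/-- The pointwise order of the C⋆-algebra `C₀(B)`. -/
instance instPartialOrderZeroAtInfty : PartialOrder C₀(B, ℂ) :=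
  PartialOrder.lift (fun f b ↦ f b) DFunLike.coe_injective

variable {H : B → Type*} [∀ b, NormedAddCommGroup (H b)] [∀ b, InnerProductSpace ℂ (H b)]

lemma zeroAtInfty_norm_apply_le (f : C₀(B, ℂ)) (b : B) : ‖f b‖ ≤ ‖f‖ :=
  f.toBCF.norm_coe_le_norm b

/-- The product of a bounded section with a function in `C₀(B)`. -/
def fieldSMul (f : C₀(B, ℂ)) (s : lp H ⊤) : lp H ⊤ :=
  ⟨fun b ↦ f b • s b, memℓp_infty ⟨‖f‖ * ‖s‖, by
    rintro _ ⟨b, rfl⟩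
    simp only [norm_smul]
    exact mul_le_mul (zeroAtInfty_norm_apply_le f b) (lp.norm_apply_le_norm ENNReal.top_ne_zero s b)
      (norm_nonneg _) (norm_nonneg _)⟩⟩

lemma fieldSMul_apply (f : C₀(B, ℂ)) (s : lp H ⊤) (b : B) : fieldSMul f s b = f b • s b := rfl

lemma fieldSMul_mem_closure {S : Submodule ℂ (lp H ⊤)}
    (hS : ∀ (f : C₀(B, ℂ)), ∀ s ∈ S, ∀ ε > 0, ∃ t ∈ S, ∀ b, ‖f b • s b - t b‖ ≤ ε)
    (f : C₀(B, ℂ)) {s : lp H ⊤} (hs : s ∈ S.topologicalClosure) :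
    fieldSMul f s ∈ S.topologicalClosure := by
  change _ ∈ closure (S : Set (lp H ⊤)) at hs ⊢
  rw [Metric.mem_closure_iff] at hs ⊢
  intro ε hε
  obtain ⟨s', hs', hd⟩ := hs (ε / 2 / (‖f‖ + 1)) (by positivity)
  obtain ⟨t, ht, htb⟩ := hS f s' hs' (ε / 4) (by positivity)
  refine ⟨t, ht, ?_⟩
  have : dist (fieldSMul f s) t ≤ ε / 2 + ε / 4 := by
    rw [dist_eq_norm]
    refine lp.norm_le_of_forall_le (by positivity) fun b ↦ ?_
    have e : (fieldSMul f s - t : lp H ⊤) b = f b • (s - s' : lp H ⊤) b + (f b • s' b - t b) := by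
      simp [fieldSMul_apply, smul_sub]
    rw [e]
    refine (norm_add_le _ _).trans (add_le_add ?_ (htb b))
    rw [norm_smul]
    have h1 : ‖(s - s' : lp H ⊤) b‖ ≤ ε / 2 / (‖f‖ + 1) :=
      (lp.norm_apply_le_norm ENNReal.top_ne_zero _ b).trans (by rw [← dist_eq_norm]; exact hd.le)
    calc ‖f b‖ * ‖(s - s' : lp H ⊤) b‖ ≤ (‖f‖ + 1) * (ε / 2 / (‖f‖ + 1)) :=
          mul_le_mul ((zeroAtInfty_norm_apply_le f b).trans (by simp)) h1 (norm_nonneg _)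
            (by positivity)
      _ = ε / 2 := by field_simp
  linarith

lemma inner_mem_closure {S : Submodule ℂ (lp H ⊤)}
    (hS : ∀ s ∈ S, ∀ t ∈ S, ∃ f : C₀(B, ℂ), ∀ b, f b = inner ℂ (s b) (t b)) {s t : lp H ⊤}
    (hs : s ∈ S.topologicalClosure) (ht : t ∈ S.topologicalClosure) :
    ∃ f : C₀(B, ℂ), ∀ b, f b = inner ℂ (s b) (t b) := by
  have key : ∀ ε > 0, ∃ f : C₀(B, ℂ), ∀ b, ‖inner ℂ (s b) (t b) - f b‖ < ε := by
    intro ε hε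
    change _ ∈ closure (S : Set (lp H ⊤)) at hs ht
    rw [Metric.mem_closure_iff] at hs ht
    obtain ⟨t', ht', hdt⟩ := ht (ε / 2 / (‖s‖ + 1)) (by positivity)
    obtain ⟨s', hs', hds⟩ := hs (ε / 2 / (‖t'‖ + 1)) (by positivity)
    obtain ⟨f, hf⟩ := hS s' hs' t' ht'
    refine ⟨f, fun b ↦ ?_⟩
    have e : inner ℂ (s b) (t b) - f b
        = inner ℂ (s b) ((t - t' : lp H ⊤) b) + inner ℂ ((s - s' : lp H ⊤) b) (t' b) := by
      simp [hf]
    rw [e]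
    rw [dist_eq_norm] at hdt hds
    have n1 := lp.norm_apply_le_norm ENNReal.top_ne_zero s b
    have n2 := lp.norm_apply_le_norm ENNReal.top_ne_zero (t - t') b
    have n3 := lp.norm_apply_le_norm ENNReal.top_ne_zero (s - s') b
    have n4 := lp.norm_apply_le_norm ENNReal.top_ne_zero t' b
    have a1 : ‖inner ℂ (s b) ((t - t' : lp H ⊤) b)‖ ≤ (‖s‖ + 1) * ‖t - t'‖ :=
      (norm_inner_le_norm _ _).trans
        (mul_le_mul (by linarith) n2 (norm_nonneg _) (by positivity))
    have a2 : ‖inner ℂ ((s - s' : lp H ⊤) b) (t' b)‖ ≤ ‖s - s'‖ * (‖t'‖ + 1) :=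
      (norm_inner_le_norm _ _).trans
        (mul_le_mul n3 (by linarith) (norm_nonneg _) (by positivity))
    rw [lt_div_iff₀ (by positivity)] at hdt hds
    calc _ ≤ _ := norm_add_le _ _
      _ < ε := by linarith
  have hcont : Continuous fun b ↦ inner ℂ (s b) (t b) := by
    refine continuous_of_uniform_approx_of_continuous fun u hu ↦ ?_
    obtain ⟨ε, hε, hεu⟩ := Metric.mem_uniformity_dist.1 hu
    obtain ⟨f, hf⟩ := key ε hε
    exact ⟨f, f.continuous, fun b ↦ hεu (by rw [dist_eq_norm]; exact hf b)⟩
  refine ⟨⟨⟨_, hcont⟩, ?_⟩, fun b ↦ rfl⟩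
  rw [Metric.tendsto_nhds]
  intro ε hε
  obtain ⟨f, hf⟩ := key (ε / 2) (by positivity)
  have := Metric.tendsto_nhds.1 f.zero_at_infty' (ε / 2) (by positivity)
  filter_upwards [this] with b hb
  have h1 := hf b
  rw [dist_zero_right] at hb ⊢
  change ‖inner ℂ (s b) (t b)‖ < ε
  change ‖f b‖ < ε / 2 at hb
  calc _ = ‖(inner ℂ (s b) (t b) - f b) + f b‖ := by simp
    _ ≤ _ := norm_add_le _ _
    _ < ε := by linarith

end Field

section L2

variable {n : ℕ} {N : Type*} [TopologicalSpace N] [ChartedSpace (EuclideanSpace ℝ (Fin n)) N]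
  [T2Space N] [SigmaCompactSpace N] [IsManifold (𝓡 n) ∞ N] [MeasurableSpace N] [BorelSpace N]
  [RiemannianBundle (fun x : N ↦ TangentSpace (𝓡 n) x)]
  [IsContMDiffRiemannianBundle (𝓡 n) ∞ (EuclideanSpace ℝ (Fin n))
    (fun x : N ↦ TangentSpace (𝓡 n) x)]
  {F : Type*} [NormedAddCommGroup F] [NormedSpace ℂ F]
  {V : N → Type*} [TopologicalSpace (TotalSpace F V)] [∀ x, NormedAddCommGroup (V x)]
  [∀ x, InnerProductSpace ℂ (V x)] [FiberBundle F V] [VectorBundle ℂ F V] [VectorBundle ℝ F V]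
  [IsSmoothHermitianBundle n F V]

lemma continuous_inner_section {s t : ∀ x, V x} (hs : s ∈ SmoothSections n F V)
    (ht : t ∈ SmoothSections n F V) : Continuous fun x ↦ inner ℂ (s x) (t x) :=
  continuous_iff_continuousAt.2 fun x ↦
    SmoothAlongAt.continuousAt_inner (n := n) (F := F) (J := 𝓡 n) (f := id) (hs x) (ht x)

lemma hasCompactSupport_inner_section {s : ∀ x, V x} (t : ∀ x, V x)
    (hs : IsCompact (sectionSupport s)) : HasCompactSupport fun x ↦ inner ℂ (s x) (t x) :=
  HasCompactSupport.intro hs fun x hx ↦ by simp [eq_zero_of_notMem_sectionSupport hx]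

lemma integrable_inner_section {U U' : Set N} {s t : ∀ x, V x} (hs : s ∈ compactSections n F V U)
    (ht : t ∈ compactSections n F V U') :
    Integrable (fun x ↦ inner ℂ (s x) (t x)) (riemannianVolume n N) :=
  (continuous_inner_section hs.1 ht.1).integrable_of_hasCompactSupport
    (hasCompactSupport_inner_section t hs.2.1)

/-- The `L²` inner product `⟨s, t⟩ = ∫ ⟨s(x), t(x)⟩ dvol(x)` on `Γ_c^∞(U, V)`. -/
@[reducible]
def testSectionsCore (U : Set N) : InnerProductSpace.Core ℂ (TestSections n F V U) where
  inner s t := ∫ x, inner ℂ (s.1 x) (t.1 x) ∂(riemannianVolume n N)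
  conj_inner_symm s t := by
    rw [← integral_conj]
    simp
  re_inner_nonneg s := by
    have h : ∀ x, inner ℂ (s.1 x) (s.1 x) = ((‖s.1 x‖ ^ 2 : ℝ) : ℂ) := fun x ↦ by
      rw [inner_self_eq_norm_sq_to_K]; simp
    simp only [h]
    rw [integral_complex_ofReal]
    exact integral_nonneg fun x ↦ by positivity
  add_left s t u := by
    rw [← integral_add (integrable_inner_section s.2 u.2) (integrable_inner_section t.2 u.2)]
    exact integral_congr_ae (Filter.Eventually.of_forall fun x ↦ inner_add_left _ _ _)
  smul_left s t r := by
    rw [← integral_const_mul]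
    exact integral_congr_ae (Filter.Eventually.of_forall fun x ↦ inner_smul_left _ _ _)
  definite s hs := by
    have h : ∀ x, inner ℂ (s.1 x) (s.1 x) = ((‖s.1 x‖ ^ 2 : ℝ) : ℂ) := fun x ↦ by
      rw [inner_self_eq_norm_sq_to_K]; simp
    have hc : Continuous fun x ↦ ‖s.1 x‖ ^ 2 := by
      have := Complex.continuous_re.comp (continuous_inner_section s.2.1 s.2.1)
      simp only [h, Function.comp_def, Complex.ofReal_re] at this
      exact this
    have hk : HasCompactSupport fun x ↦ ‖s.1 x‖ ^ 2 :=
      HasCompactSupport.intro s.2.2.1 fun x hx ↦ by simp [eq_zero_of_notMem_sectionSupport hx]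
    change ∫ x, inner ℂ (s.1 x) (s.1 x) ∂(riemannianVolume n N) = 0 at hs
    simp only [h] at hs
    rw [integral_complex_ofReal, Complex.ofReal_eq_zero] at hs
    by_contra hne
    have : ∃ x, s.1 x ≠ 0 := by
      by_contra hx
      push Not at hx
      exact hne (Subtype.ext (funext hx))
    obtain ⟨x, hx⟩ := this
    exact (hc.integral_pos_of_hasCompactSupport_nonneg_nonzero hk (fun x ↦ by positivity)
      (x := x) (by simpa using hx)).ne' hs

instance (U : Set N) : NormedAddCommGroup (TestSections n F V U) :=
  (testSectionsCore U).toNormedAddCommGroup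

instance (U : Set N) : InnerProductSpace ℂ (TestSections n F V U) :=
  InnerProductSpace.ofCore (testSectionsCore U).toCore

lemma testSections_inner (U : Set N) (s t : TestSections n F V U) :
    inner ℂ s t = ∫ x, inner ℂ (s.1 x) (t.1 x) ∂(riemannianVolume n N) := rfl

variable (n F V) in
/-- The Hilbert space `L²(U, V)`: the completion of `Γ_c^∞(U, V)` in the `L²` norm. -/
abbrev SectionsL2 (U : Set N) : Type _ := UniformSpace.Completion (TestSections n F V U)

variable {m : ℕ} {B : Type*} [TopologicalSpace B] [ChartedSpace (EuclideanSpace ℝ (Fin m)) B]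

variable (M : Set (N × B))

/-- The section `ψ(·, b)` as an element of `L²(M_b, V)`. -/
def sliceL2 (b : B) : totalSections n F V m B M →ₗ[ℂ] SectionsL2 n F V (fibre M b) :=
  (UniformSpace.Completion.toComplₗᵢ (𝕜 := ℂ) (E := TestSections n F V (fibre M b))).toLinearMap ∘ₗ
    slice M b

variable {M}

lemma sliceL2_inner (b : B) (ψ φ : totalSections n F V m B M) :
    inner ℂ (sliceL2 M b ψ) (sliceL2 M b φ) =
      ∫ x, inner ℂ (ψ.1 (x, b)) (φ.1 (x, b)) ∂(riemannianVolume n N) :=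
  (UniformSpace.Completion.inner_coe (𝕜 := ℂ) (E := TestSections n F V (fibre M b))
    (slice M b ψ) (slice M b φ)).trans (testSections_inner _ _ _)

lemma exists_inner_totalSections (ψ φ : totalSections n F V m B M) :
    ∃ f : C₀(B, ℂ), ∀ b, f b = inner ℂ (sliceL2 M b ψ) (sliceL2 M b φ) := by
  have hc : Continuous (fun p : N × B ↦ inner ℂ (ψ.1 p) (φ.1 p)) :=
    continuous_iff_continuousAt.2 fun p ↦ SmoothAlongAt.continuousAt_inner (n := n) (F := F)
      (J := (𝓡 n).prod (𝓡 m)) (f := Prod.fst) (ψ.2.1 p) (φ.2.1 p)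
  have hK : IsCompact (Prod.fst '' sectionSupport ψ.1) := ψ.2.2.1.image continuous_fst
  have hL : IsCompact (Prod.snd '' sectionSupport ψ.1) := ψ.2.2.1.image continuous_snd
  have hcont : Continuous fun b ↦
      ∫ x, inner ℂ (ψ.1 (x, b)) (φ.1 (x, b)) ∂(riemannianVolume n N) := by
    rw [← continuousOn_univ]
    refine continuousOn_integral_of_compact_support hK
      (f := fun b x ↦ inner ℂ (ψ.1 (x, b)) (φ.1 (x, b))) ?_ ?_
    · exact (hc.comp continuous_swap).continuousOn
    · intro b x _ hx
      have : ψ.1 (x, b) = 0 := eq_zero_of_notMem_sectionSupport fun h ↦ hx ⟨_, h, rfl⟩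
      simp [this]
  refine ⟨⟨⟨_, hcont⟩, ?_⟩, fun b ↦ (sliceL2_inner b ψ φ).symm⟩
  refine Filter.Tendsto.congr' ?_ tendsto_const_nhds
  filter_upwards [hL.compl_mem_cocompact] with b hb
  have : ∀ x, ψ.1 (x, b) = 0 := fun x ↦ eq_zero_of_notMem_sectionSupport fun h ↦ hb ⟨_, h, rfl⟩
  simp [this]

lemma exists_norm_sliceL2_le (ψ : totalSections n F V m B M) :
    ∃ C : ℝ, 0 ≤ C ∧ ∀ b, ‖sliceL2 M b ψ‖ ≤ C := by
  obtain ⟨f, hf⟩ := exists_inner_totalSections ψ ψ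
  refine ⟨√‖f‖, Real.sqrt_nonneg _, fun b ↦ Real.le_sqrt_of_sq_le ?_⟩
  have h := zeroAtInfty_norm_apply_le f b
  rw [hf, inner_self_eq_norm_sq_to_K] at h
  simpa using h

lemma exists_smul_totalSections [IsManifold (𝓡 m) ∞ B] [SigmaCompactSpace B] [T2Space B]
    (f : C₀(B, ℂ)) (ψ : totalSections n F V m B M) {ε : ℝ} (hε : 0 < ε) :
    ∃ φ : totalSections n F V m B M, ∀ b, ‖f b • sliceL2 M b ψ - sliceL2 M b φ‖ ≤ ε := by
  obtain ⟨C, hC0, hC⟩ := exists_norm_sliceL2_le ψ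
  obtain ⟨g, hg, -⟩ := f.continuous.exists_contMDiff_approx (𝓡 m) ⊤
    (continuous_const (y := ε / (C + 1))) (fun _ ↦ by positivity)
  have hsupp : sectionSupport (fun p : N × B ↦ g p.2 • ψ.1 p) ⊆ sectionSupport ψ.1 :=
    sectionSupport_mono fun p hp ↦ by simp [hp]
  let φ : totalSections n F V m B M := ⟨fun p ↦ g p.2 • ψ.1 p,
    fun p ↦ SmoothAlongAt.smul (f := Prod.fst)
      (g.contMDiff.contMDiffAt.comp p contMDiffAt_snd) (ψ.2.1 p),
    ψ.2.2.1.of_isClosed_subset isClosed_closure hsupp, hsupp.trans ψ.2.2.2⟩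
  refine ⟨φ, fun b ↦ ?_⟩
  have h1 : slice M b φ = g b • slice M b ψ := rfl
  have h2 : sliceL2 M b φ = g b • sliceL2 M b ψ := by
    simp only [sliceL2, LinearMap.comp_apply, h1, map_smul]
  rw [h2, ← sub_smul, norm_smul, ← dist_eq_norm, dist_comm]
  calc dist (g b) (f b) * ‖sliceL2 M b ψ‖ ≤ ε / (C + 1) * (C + 1) :=
        mul_le_mul (hg b).le ((hC b).trans (by linarith)) (norm_nonneg _) (by positivity)
    _ = ε := by field_simp

variable (M) in
/-- A compactly supported smooth section over `M` as a bounded section of the field of Hilbert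
spaces `b ↦ L²(M_b, V)`, with the norm `sup_b ‖ψ(·, b)‖`. -/
def totalToField : totalSections n F V m B M →ₗ[ℂ]
    lp (fun b ↦ SectionsL2 n F V (fibre M b)) ⊤ where
  toFun ψ := ⟨fun b ↦ sliceL2 M b ψ, memℓp_infty (by
    obtain ⟨C, -, hC⟩ := exists_norm_sliceL2_le ψ
    exact ⟨C, by rintro _ ⟨b, rfl⟩; exact hC b⟩)⟩
  map_add' ψ φ := by ext b : 2; exact map_add _ _ _
  map_smul' c ψ := by ext b : 2; exact map_smul _ _ _

lemma totalToField_apply (ψ : totalSections n F V m B M) (b : B) :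
    totalToField M ψ b = sliceL2 M b ψ := rfl

lemma totalToField_injective : Function.Injective
    (totalToField M : totalSections n F V m B M →ₗ[ℂ] _) := by
  intro ψ φ h
  refine Subtype.ext (funext fun p ↦ ?_)
  have h1 : sliceL2 M p.2 ψ = sliceL2 M p.2 φ := by
    rw [← totalToField_apply, ← totalToField_apply, h]
  have h2 : slice M p.2 ψ = slice M p.2 φ :=
    (UniformSpace.Completion.toComplₗᵢ (𝕜 := ℂ)
      (E := TestSections n F V (fibre M p.2))).injective h1
  exact congrFun (congrArg Subtype.val h2) p.1

variable (n F V m B M) in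
/-- The Hilbert `C₀(B)`-module `Γ₀(B, E_•)` with `E_b = L²(M_b, V)`: the completion of
`Γ_c^∞(M, V)` for the norm `sup_b ‖ψ(·, b)‖`, realised by sections of `E_•`. -/
def FieldModule : Submodule ℂ (lp (fun b ↦ SectionsL2 n F V (fibre M b)) ⊤) :=
  (LinearMap.range (totalToField (m := m) M)).topologicalClosure

lemma exists_inner_fieldModule (s t : FieldModule n F V m B M) :
    ∃ f : C₀(B, ℂ), ∀ b, f b = inner ℂ (s.1 b) (t.1 b) := by
  refine inner_mem_closure ?_ s.2 t.2
  rintro _ ⟨ψ, rfl⟩ _ ⟨φ, rfl⟩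
  exact exists_inner_totalSections ψ φ

variable [IsManifold (𝓡 m) ∞ B] [SigmaCompactSpace B] [T2Space B]

/-- `C₀(B)` acts on `Γ₀(B, E_•)` by pointwise multiplication. -/
instance : SMul C₀(B, ℂ) (FieldModule n F V m B M) where
  smul f s := ⟨fieldSMul f s.1, by
    refine fieldSMul_mem_closure ?_ f s.2
    rintro f _ ⟨ψ, rfl⟩ ε hε
    obtain ⟨φ, hφ⟩ := exists_smul_totalSections f ψ hε
    exact ⟨_, ⟨φ, rfl⟩, hφ⟩⟩

lemma fieldModule_smul_apply (f : C₀(B, ℂ)) (s : FieldModule n F V m B M) (b : B) :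
    (f • s).1 b = f b • s.1 b := rfl

/-- The `C₀(B)`-valued inner product `⟨s, t⟩(b) = ⟨s(b), t(b)⟩`. -/
instance : Inner C₀(B, ℂ) (FieldModule n F V m B M) where
  inner s t := (exists_inner_fieldModule s t).choose

lemma fieldModule_inner_apply (s t : FieldModule n F V m B M) (b : B) :
    inner C₀(B, ℂ) s t b = inner ℂ (s.1 b) (t.1 b) :=
  (exists_inner_fieldModule s t).choose_spec b

instance : CStarModule C₀(B, ℂ) (FieldModule n F V m B M) where
  inner_add_right {s t u} := by
    ext b
    simp [fieldModule_inner_apply, inner_add_right]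
  inner_self_nonneg {s} := by
    intro b
    simp only [fieldModule_inner_apply, ZeroAtInftyContinuousMap.coe_zero, Pi.zero_apply]
    rw [inner_self_eq_norm_sq_to_K]
    simp
  inner_self {s} := by
    constructor
    · intro h
      refine Subtype.ext (lp.ext (funext fun b ↦ ?_))
      have := fieldModule_inner_apply s s b
      rw [h] at this
      exact inner_self_eq_zero.1 this.symm
    · rintro rfl
      ext b
      simp [fieldModule_inner_apply]
  inner_op_smul_right {f s t} := by
    ext b
    simp [fieldModule_inner_apply, fieldModule_smul_apply, inner_smul_right]
  inner_smul_right_complex {c s t} := by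
    ext b
    simp [fieldModule_inner_apply, inner_smul_right]
  star_inner s t := by
    ext b
    simp [fieldModule_inner_apply]
  norm_eq_sqrt_norm_inner_self s := by
    refine le_antisymm ?_ ?_
    · refine lp.norm_le_of_forall_le (Real.sqrt_nonneg _) fun b ↦ Real.le_sqrt_of_sq_le ?_
      have h := zeroAtInfty_norm_apply_le (inner C₀(B, ℂ) s s) b
      rw [fieldModule_inner_apply, inner_self_eq_norm_sq_to_K] at h
      simpa using h
    · rw [Real.sqrt_le_left (norm_nonneg _), ← ZeroAtInftyContinuousMap.norm_toBCF_eq_norm,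
        BoundedContinuousFunction.norm_le (by positivity)]
      intro b
      change ‖inner C₀(B, ℂ) s s b‖ ≤ _
      rw [fieldModule_inner_apply, inner_self_eq_norm_sq_to_K]
      have : ‖s.1 b‖ ≤ ‖s‖ := lp.norm_apply_le_norm ENNReal.top_ne_zero s.1 b
      simpa using pow_le_pow_left₀ (norm_nonneg _) this 2

instance : CompleteSpace (FieldModule n F V m B M) :=
  (Submodule.isClosed_topologicalClosure _).completeSpace_coe

end L2

section DiffOp

variable {n : ℕ} {N : Type*} [TopologicalSpace N] [ChartedSpace (EuclideanSpace ℝ (Fin n)) N]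
  [T2Space N] [IsManifold (𝓡 n) ∞ N]
  {F : Type*} [NormedAddCommGroup F] [NormedSpace ℂ F]
  {V : N → Type*} [TopologicalSpace (TotalSpace F V)] [∀ x, NormedAddCommGroup (V x)]
  [∀ x, InnerProductSpace ℂ (V x)] [FiberBundle F V] [VectorBundle ℂ F V]

/-- The section `s`, read in the chart at `x₀` and the trivialization of `V` at `x₀`. -/
def sectionInCoord (n : ℕ) [ChartedSpace (EuclideanSpace ℝ (Fin n)) N] (F : Type*)
    [NormedAddCommGroup F] [NormedSpace ℂ F] [TopologicalSpace (TotalSpace F V)] [FiberBundle F V]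
    (x₀ : N) (s : ∀ x, V x) (y : EuclideanSpace ℝ (Fin n)) : F :=
  (trivializationAt F V x₀ (TotalSpace.mk' F ((chartAt (EuclideanSpace ℝ (Fin n)) x₀).symm y)
    (s ((chartAt (EuclideanSpace ℝ (Fin n)) x₀).symm y)))).2

variable (n F V) in
/-- The part of the chart at `x₀` over which the trivialization of `V` at `x₀` is defined. -/
def coordDomain (x₀ : N) : Set (EuclideanSpace ℝ (Fin n)) :=
  (chartAt (EuclideanSpace ℝ (Fin n)) x₀).target ∩
    (chartAt (EuclideanSpace ℝ (Fin n)) x₀).symm ⁻¹' (trivializationAt F V x₀).baseSet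

variable (n F V) in
/-- A first-order differential operator on the smooth sections of `V`: in local coordinates it has
the form `s ↦ ∑ᵢ Pᵢ ∂ᵢ s + Q s` with smooth coefficients. Here `P y` takes the total
derivative of `s` at `y` to `∑ᵢ Pᵢ(y) ∂ᵢ s(y)`. -/
structure FirstOrderDiffOp where
  toLinearMap : SmoothSections n F V →ₗ[ℂ] SmoothSections n F V
  exists_coord : ∀ x₀ : N,
    ∃ (P : EuclideanSpace ℝ (Fin n) → (EuclideanSpace ℝ (Fin n) →L[ℝ] F) →L[ℝ] F)
      (Q : EuclideanSpace ℝ (Fin n) → F →L[ℝ] F),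
      ContDiffOn ℝ ∞ P (coordDomain n F V x₀) ∧ ContDiffOn ℝ ∞ Q (coordDomain n F V x₀) ∧
      ∀ s : SmoothSections n F V, ∀ y ∈ coordDomain n F V x₀,
        sectionInCoord n F x₀ (toLinearMap s).1 y =
          P y (fderiv ℝ (sectionInCoord n F x₀ s.1) y) + Q y (sectionInCoord n F x₀ s.1 y)

/-- The product `f s` of a smooth function and a smooth section. -/
def mulSection (f : C^∞⟮𝓡 n, N; 𝓘(ℝ, ℝ), ℝ⟯) (s : SmoothSections n F V) : SmoothSections n F V :=
  ⟨fun x ↦ (f x : ℂ) • s.1 x, fun x ↦ SmoothAlongAt.smul (f := id)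
    (Complex.ofRealCLM.contDiff.contMDiff.contMDiffAt.comp x f.contMDiff.contMDiffAt) (s.2 x)⟩

/-- `D` is elliptic: for every covector `ξ = df(x) ≠ 0`, the principal symbol
`σ(ξ) : V_x → V_x`, `s(x) ↦ ([D, f] s)(x)`, is invertible. -/
def FirstOrderDiffOp.IsElliptic (D : FirstOrderDiffOp n F V) : Prop :=
  ∀ (x : N) (f : C^∞⟮𝓡 n, N; 𝓘(ℝ, ℝ), ℝ⟯), mfderiv (𝓡 n) 𝓘(ℝ, ℝ) f x ≠ 0 →
    ∃ σ : V x ≃ₗ[ℂ] V x, ∀ s : SmoothSections n F V,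
      (D.toLinearMap (mulSection f s) - mulSection f (D.toLinearMap s)).1 x = σ (s.1 x)

/-- `D` is symmetric on the compactly supported smooth sections, for the `L²` inner product. -/
def FirstOrderDiffOp.IsSymmetric [SigmaCompactSpace N] [MeasurableSpace N]
    [RiemannianBundle (fun x : N ↦ TangentSpace (𝓡 n) x)] (D : FirstOrderDiffOp n F V) : Prop :=
  ∀ s t : SmoothSections n F V, IsCompact (sectionSupport s.1) → IsCompact (sectionSupport t.1) →
    ∫ x, inner ℂ ((D.toLinearMap s).1 x) (t.1 x) ∂(riemannianVolume n N) =
      ∫ x, inner ℂ (s.1 x) ((D.toLinearMap t).1 x) ∂(riemannianVolume n N)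

variable {m : ℕ} {B : Type*} [TopologicalSpace B] [ChartedSpace (EuclideanSpace ℝ (Fin m)) B]
  [IsManifold (𝓡 m) ∞ B]
  {M : Set (N × B)}

/-- The section `ψ(·, b)` of `V` over `N`, extended by zero outside `M_b`. -/
def sliceSection (b : B) : totalSections n F V m B M →ₗ[ℂ] SmoothSections n F V where
  toFun ψ := ⟨(slice M b ψ).1, (slice M b ψ).2.1⟩
  map_add' _ _ := rfl
  map_smul' _ _ := rfl

lemma sliceSection_apply (b : B) (ψ : totalSections n F V m B M) (x : N) :
    (sliceSection b ψ).1 x = ψ.1 (x, b) := rfl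

lemma chart_mem_coordDomain {x₀ x : N} (hx : x ∈ (chartAt (EuclideanSpace ℝ (Fin n)) x₀).source)
    (hx' : x ∈ (trivializationAt F V x₀).baseSet) :
    chartAt (EuclideanSpace ℝ (Fin n)) x₀ x ∈ coordDomain n F V x₀ :=
  ⟨(chartAt _ x₀).map_source hx, by simpa [(chartAt _ x₀).left_inv hx] using hx'⟩

lemma isOpen_coordDomain (x₀ : N) : IsOpen (coordDomain n F V x₀) :=
  (chartAt (EuclideanSpace ℝ (Fin n)) x₀).isOpen_inter_preimage_symm
    (trivializationAt F V x₀).open_baseSet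

lemma sectionInCoord_chart {x₀ x : N} (hx : x ∈ (chartAt (EuclideanSpace ℝ (Fin n)) x₀).source)
    (s : ∀ x, V x) : sectionInCoord n F x₀ s (chartAt (EuclideanSpace ℝ (Fin n)) x₀ x) =
      (trivializationAt F V x₀ (TotalSpace.mk' F x (s x))).2 := by
  rw [sectionInCoord, (chartAt _ x₀).left_inv hx]

/-- Differential operators are local. -/
lemma FirstOrderDiffOp.eq_zero_of_eventually (D : FirstOrderDiffOp n F V)
    (s : SmoothSections n F V) (x : N) (h : ∀ᶠ z in 𝓝 x, s.1 z = 0) :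
    (D.toLinearMap s).1 x = 0 := by
  obtain ⟨P, Q, -, -, hD⟩ := D.exists_coord x
  set φ := chartAt (EuclideanSpace ℝ (Fin n)) x with hφ
  have hxs : x ∈ φ.source := mem_chart_source _ x
  have hxb : x ∈ (trivializationAt F V x).baseSet := FiberBundle.mem_baseSet_trivializationAt' x
  have h0 : sectionInCoord n F x s.1 =ᶠ[𝓝 (φ x)] fun _ ↦ 0 := by
    have hc : Filter.Tendsto φ.symm (𝓝 (φ x)) (𝓝 x) := by
      have := φ.continuousAt_symm (φ.map_source hxs)
      rwa [ContinuousAt, φ.left_inv hxs] at this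
    filter_upwards [hc.eventually h,
      hc.eventually_mem ((trivializationAt F V x).open_baseSet.mem_nhds hxb)] with y hy hy'
    rw [sectionInCoord, hy]
    exact ((trivializationAt F V x).linear ℂ hy').map_zero
  have h1 := hD s (φ x) (chart_mem_coordDomain hxs hxb)
  rw [h0.fderiv_eq, h0.eq_of_nhds, sectionInCoord_chart hxs] at h1
  simp only [fderiv_fun_const, Pi.zero_apply, map_zero, add_zero] at h1
  let e := ((trivializationAt F V x).continuousLinearEquivAt ℂ x hxb)
  have h2 : e ((D.toLinearMap s).1 x) = 0 := by
    simpa [e] using h1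
  exact (map_eq_zero_iff e e.injective).1 h2

lemma FirstOrderDiffOp.smooth_vertical (D : FirstOrderDiffOp n F V)
    (ψ : totalSections n F V m B M) (p₀ : N × B) :
    SmoothAlongAt n F ((𝓡 n).prod (𝓡 m)) Prod.fst
      (fun p : N × B ↦ (D.toLinearMap (sliceSection p.2 ψ)).1 p.1) p₀ := by
  obtain ⟨P, Q, hP, hQ, hD⟩ := D.exists_coord p₀.1
  set φ := chartAt (EuclideanSpace ℝ (Fin n)) p₀.1 with hφ
  set e := trivializationAt F V p₀.1 with he
  have hxs : p₀.1 ∈ φ.source := mem_chart_source _ p₀.1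
  have hxb : p₀.1 ∈ e.baseSet := FiberBundle.mem_baseSet_trivializationAt' p₀.1
  have hφs : ContMDiffAt (𝓡 n) (𝓡 n) ∞ φ p₀.1 := contMDiffAt_of_mem_maximalAtlas
    (IsManifold.chart_mem_maximalAtlas p₀.1) hxs
  have hφs' : ContMDiffAt (𝓡 n) (𝓡 n) ∞ φ.symm (φ p₀.1) :=
    contMDiffAt_symm_of_mem_maximalAtlas (IsManifold.chart_mem_maximalAtlas p₀.1)
      (φ.map_source hxs)
  have hg : ContMDiffAt ((𝓡 n).prod (𝓡 m)) (𝓡 n) ∞ (fun p : N × B ↦ φ p.1) p₀ :=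
    hφs.comp p₀ contMDiffAt_fst
  have hy : φ p₀.1 ∈ coordDomain n F V p₀.1 := chart_mem_coordDomain hxs hxb
  have hf : ContMDiffAt (((𝓡 n).prod (𝓡 m)).prod (𝓡 n)) 𝓘(ℝ, F) ∞
      (Function.uncurry fun (p : N × B) (y : EuclideanSpace ℝ (Fin n)) ↦
        sectionInCoord n F p₀.1 (sliceSection p.2 ψ).1 y) (p₀, φ p₀.1) := by
    have h1 := (smoothAlongAt_iff.1 (show SmoothAlongAt n F ((𝓡 n).prod (𝓡 m)) Prod.fst ψ.1 p₀
      from ψ.2.1 p₀)).2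
    have h2 : ContMDiffAt (((𝓡 n).prod (𝓡 m)).prod (𝓡 n)) ((𝓡 n).prod (𝓡 m)) ∞
        (fun q : (N × B) × EuclideanSpace ℝ (Fin n) ↦ (φ.symm q.2, q.1.2)) (p₀, φ p₀.1) :=
      (hφs'.comp (p₀, φ p₀.1) contMDiffAt_snd).prodMk
        (contMDiffAt_snd.comp (p₀, φ p₀.1) contMDiffAt_fst)
    exact h1.comp_of_eq h2 (by simp [φ.left_inv hxs])
  have hder : ContMDiffAt ((𝓡 n).prod (𝓡 m)) 𝓘(ℝ, EuclideanSpace ℝ (Fin n) →L[ℝ] F) ∞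
      (fun p : N × B ↦ fderiv ℝ (sectionInCoord n F p₀.1 (sliceSection p.2 ψ).1) (φ p.1)) p₀ := by
    have : IsManifold ((𝓡 n).prod (𝓡 m)) 1 (N × B) := IsManifold.of_le (n := ∞) (by simp)
    have : IsManifold 𝓘(ℝ, F) 1 F := instIsManifoldModelSpace
    have h := ContMDiffAt.mfderiv (I := 𝓡 n) (I' := 𝓘(ℝ, F)) (m := ∞) _ _ hf hg (by simp)
    simpa only [inTangentCoordinates_model_space, mfderiv_eq_fderiv] using h
  have hval : ContMDiffAt ((𝓡 n).prod (𝓡 m)) 𝓘(ℝ, F) ∞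
      (fun p : N × B ↦ sectionInCoord n F p₀.1 (sliceSection p.2 ψ).1 (φ p.1)) p₀ :=
    ContMDiffAt.comp (f := fun p : N × B ↦ (p, φ p.1)) p₀ hf (contMDiffAt_id.prodMk hg)
  have hPs := ((hP.contDiffAt ((isOpen_coordDomain p₀.1).mem_nhds hy)).contMDiffAt.comp p₀ hg)
  have hQs := ((hQ.contDiffAt ((isOpen_coordDomain p₀.1).mem_nhds hy)).contMDiffAt.comp p₀ hg)
  rw [smoothAlongAt_iff]
  refine ⟨contMDiffAt_fst,
    ((hPs.clm_apply hder).add (hQs.clm_apply hval)).congr_of_eventuallyEq ?_⟩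
  have hc : Filter.Tendsto Prod.fst (𝓝 p₀) (𝓝 p₀.1) := continuous_fst.continuousAt
  filter_upwards [hc.eventually_mem (φ.open_source.mem_nhds hxs),
    hc.eventually_mem (e.open_baseSet.mem_nhds hxb)] with p hp hp'
  rw [← sectionInCoord_chart hp]
  exact hD _ _ (chart_mem_coordDomain hp hp')

variable (M) in
/-- The vertical operator induced by `D` on `Γ_c^∞(M, V)`:
`(𝓓 ψ)(x, b) = (D ψ(·, b))(x)`. -/
def FirstOrderDiffOp.vertical (D : FirstOrderDiffOp n F V) :
    totalSections n F V m B M →ₗ[ℂ] totalSections n F V m B M where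
  toFun ψ := ⟨fun p ↦ (D.toLinearMap (sliceSection p.2 ψ)).1 p.1, by
    have h : sectionSupport (fun p : N × B ↦ (D.toLinearMap (sliceSection p.2 ψ)).1 p.1) ⊆
        sectionSupport ψ.1 := by
      refine closure_minimal (fun p hp ↦ ?_) isClosed_closure
      by_contra hn
      refine hp (D.eq_zero_of_eventually _ _ ?_)
      have hc : Filter.Tendsto (fun z : N ↦ (z, p.2)) (𝓝 p.1) (𝓝 p) :=
        (Continuous.prodMk_left p.2).tendsto p.1
      filter_upwards [hc.eventually_mem (isClosed_closure.isOpen_compl.mem_nhds hn)] with z hz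
      exact eq_zero_of_notMem_sectionSupport (s := ψ.1) hz
    exact ⟨fun p ↦ D.smooth_vertical ψ p, ψ.2.2.1.of_isClosed_subset isClosed_closure h,
      h.trans ψ.2.2.2⟩⟩
  map_add' ψ φ := by ext p; simp
  map_smul' c ψ := by ext p; simp

end DiffOp

section Regular

/-- A regular operator on a Hilbert C⋆-module `E` over `A`: a closed, densely defined, `A`-linear
operator `T` with densely defined adjoint `T⋆` such that `1 + T⋆T` has dense range. -/
structure IsRegularOperator (A : Type*) {E : Type*} [NonUnitalCStarAlgebra A] [PartialOrder A]
    [NormedAddCommGroup E] [NormedSpace ℂ E] [SMul A E] [CStarModule A E]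
    (T : E →ₗ.[ℂ] E) : Prop where
  isClosed : T.IsClosed
  dense_domain : Dense (T.domain : Set E)
  map_smul : ∀ (a : A) (x : T.domain), ∃ h : a • (x : E) ∈ T.domain, T ⟨a • (x : E), h⟩ = a • T x
  dense_adjoint_domain :
    Dense {y : E | ∃ z : E, ∀ x : T.domain, inner A (T x) y = inner A (x : E) z}
  dense_range_one_add : Dense {w : E | ∃ x : T.domain, ∃ z : E,
    (∀ x' : T.domain, inner A (T x') (T x) = inner A (x' : E) z) ∧ w = (x : E) + z}

end Regular

section Vertical

variable {n : ℕ} {N : Type*} [TopologicalSpace N] [ChartedSpace (EuclideanSpace ℝ (Fin n)) N]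
  [T2Space N] [SigmaCompactSpace N] [IsManifold (𝓡 n) ∞ N] [MeasurableSpace N] [BorelSpace N]
  [RiemannianBundle (fun x : N ↦ TangentSpace (𝓡 n) x)]
  [IsContMDiffRiemannianBundle (𝓡 n) ∞ (EuclideanSpace ℝ (Fin n))
    (fun x : N ↦ TangentSpace (𝓡 n) x)]
  {F : Type*} [NormedAddCommGroup F] [NormedSpace ℂ F]
  {V : N → Type*} [TopologicalSpace (TotalSpace F V)] [∀ x, NormedAddCommGroup (V x)]
  [∀ x, InnerProductSpace ℂ (V x)] [FiberBundle F V] [VectorBundle ℂ F V] [VectorBundle ℝ F V]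
  [IsSmoothHermitianBundle n F V]
  {m : ℕ} {B : Type*} [TopologicalSpace B] [ChartedSpace (EuclideanSpace ℝ (Fin m)) B]
  [IsManifold (𝓡 m) ∞ B] (M : Set (N × B))

/-- The canonical map `Γ_c^∞(M, V) → Γ₀(B, E_•)`. -/
def totalToModule : totalSections n F V m B M →ₗ[ℂ] FieldModule n F V m B M :=
  (totalToField M).codRestrict _
    (fun ψ ↦ Submodule.le_topologicalClosure _ (LinearMap.mem_range_self _ ψ))

lemma totalToModule_injective : Function.Injective
    (totalToModule M : totalSections n F V m B M →ₗ[ℂ] FieldModule n F V m B M) :=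
  fun _ _ h ↦ totalToField_injective (congrArg Subtype.val h)

/-- The vertical operator induced by `D`, with initial domain `Γ_c^∞(M, V)`, as an unbounded
operator on the Hilbert module `Γ₀(B, E_•)`. -/
def FirstOrderDiffOp.verticalOperator (D : FirstOrderDiffOp n F V) :
    FieldModule n F V m B M →ₗ.[ℂ] FieldModule n F V m B M where
  domain := LinearMap.range (totalToModule M)
  toFun := totalToModule M ∘ₗ D.vertical M ∘ₗ
    (LinearEquiv.ofInjective (totalToModule M) (totalToModule_injective M)).symm.toLinearMap

end Vertical

section Sobolev

variable {n : ℕ} {N : Type*} [TopologicalSpace N] [ChartedSpace (EuclideanSpace ℝ (Fin n)) N]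

/-- The complex-valued one-form `α` is the weak differential of the function `u`: in every chart
both are locally integrable, and `∫ u ∂_v η dy = - ∫ α(v) η dy` for all test functions `η` and all
constant coordinate vector fields `v`. -/
def IsWeakDifferential (u : N → ℂ) (α : ∀ x : N, TangentSpace (𝓡 n) x →L[ℝ] ℂ) : Prop :=
  ∀ x₀ : N,
    LocallyIntegrableOn (fun y ↦ u ((chartAt (EuclideanSpace ℝ (Fin n)) x₀).symm y))
      (chartAt (EuclideanSpace ℝ (Fin n)) x₀).target ∧
    ∀ v : EuclideanSpace ℝ (Fin n),
      LocallyIntegrableOn (fun y ↦ α ((chartAt (EuclideanSpace ℝ (Fin n)) x₀).symm y)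
        (chartVector x₀ y v)) (chartAt (EuclideanSpace ℝ (Fin n)) x₀).target ∧
      ∀ η : EuclideanSpace ℝ (Fin n) → ℝ, ContDiff ℝ ∞ η → HasCompactSupport η →
        tsupport η ⊆ (chartAt (EuclideanSpace ℝ (Fin n)) x₀).target →
        ∫ y, (fderiv ℝ η y v : ℂ) * u ((chartAt (EuclideanSpace ℝ (Fin n)) x₀).symm y) =
          - ∫ y, (η y : ℂ) * α ((chartAt (EuclideanSpace ℝ (Fin n)) x₀).symm y)
            (chartVector x₀ y v)

variable [T2Space N] [SigmaCompactSpace N] [IsManifold (𝓡 n) ∞ N] [MeasurableSpace N]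
  [RiemannianBundle (fun x : N ↦ TangentSpace (𝓡 n) x)]

/-- The square `∫ (|u|² + |α|²) dvol` of the `H¹`-norm of a function `u` with differential `α`.
The pointwise norm of a complex one-form is `|α|² = |Re α|² + |Im α|²`, with the norms of real
covectors dual to the Riemannian metric. -/
def sobolevNormSq (u : N → ℂ) (α : ∀ x : N, TangentSpace (𝓡 n) x →L[ℝ] ℂ) : ENNReal :=
  ∫⁻ x, ENNReal.ofReal (‖u x‖ ^ 2 + (‖Complex.reCLM ∘L α x‖ ^ 2 + ‖Complex.imCLM ∘L α x‖ ^ 2))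
    ∂(riemannianVolume n N)

/-- `u` is an element of `H¹_c(N)` with weak differential `α`. -/
structure IsCompactSobolev (u : N → ℂ) (α : ∀ x : N, TangentSpace (𝓡 n) x →L[ℝ] ℂ) : Prop where
  isWeakDifferential : IsWeakDifferential u α
  finite_norm : sobolevNormSq u α < ⊤
  compact_support : ∃ K : Set N, IsCompact K ∧ ∀ᵐ x ∂(riemannianVolume n N), x ∉ K → u x = 0

/-- The differential of a complex-valued function. -/
def differential (χ : N → ℂ) (x : N) : TangentSpace (𝓡 n) x →L[ℝ] ℂ :=
  mfderiv (𝓡 n) 𝓘(ℝ, ℂ) χ x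

variable (n N) in
/-- `C_c^∞(U)` is dense in `H¹_c(N)` with respect to the `H¹`-norm. -/
def DenseInCompactSobolev (U : Set N) : Prop :=
  ∀ (u : N → ℂ) (α : ∀ x : N, TangentSpace (𝓡 n) x →L[ℝ] ℂ), IsCompactSobolev u α →
    ∀ ε : ENNReal, 0 < ε → ∃ χ : N → ℂ, ContMDiff (𝓡 n) 𝓘(ℝ, ℂ) ∞ χ ∧ HasCompactSupport χ ∧
      tsupport χ ⊆ U ∧
      sobolevNormSq (u - χ) (fun x ↦ α x - differential χ x) < ε

end Sobolev

/-- `(N ∖ C_N × B) ∪ (N × B ∖ C_B)`. -/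
def removedProduct {N B : Type*} (CN : Set N) (CB : Set B) : Set (N × B) :=
  (CNᶜ ×ˢ univ) ∪ (univ ×ˢ CBᶜ)

end

/-! Put `U₀ = N ∖ C_N`, which lies in every fibre `M_b`. The density hypothesis makes the complement
of `U₀` invisible to first-order operators: every compactly supported smooth section `s` over `M_b`
is a limit, in the graph norm of `D`, of sections supported in `U₀`. Indeed, take a cutoff `u` equal
to 1 on the support of `s` and `χ ∈ C_c^∞(U₀)` close to `u` in `H¹`. Then `s - χ s = (u - χ) s`,
while `D ((u - χ) s) = (u - χ) D s + [D, u - χ] s`. The commutator is of order zero and is bounded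
pointwise by a constant times `|d(u - χ)|`, so both differences are small in `L²`
(`exists_eventually_norm_commutator_le`, `exists_testSections_approx`).

Hence, up to extension by zero, the closures of `D` on all the `L²(M_b)` are one operator on
`L²(U₀)`, and the field of operators over `B` is constant. In the Hilbert space `L²(U₀)` the
equation `(1 + T⋆T) x = w` is solved for the closure `T` by projecting `(w, 0)` orthogonally onto
the closed graph (`exists_mem_topologicalClosure_inner_eq`). Multiplying the solution by `g ∈
C_c^∞(B)` solves the equation for `b ↦ g(b) w` in the Hilbert module. The adjoint relation, known
against sections over `U₀`, extends to all sections over `M_b` by the approximation above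
(`inner_l2Inclusion_eq`, `moduleTensor_mem_oneAddRange`).

Finite sums of the elements `g ⊗ w` are dense: near each `b₀` a section is uniformly close to a
constant one, and a partition of unity on `B` glues these approximations (`dense_oneAddRange`).
Closability and the dense domain of the adjoint come from symmetry; `C₀(B)`-linearity holds because
`D` does not differentiate along `B`. -/

/-! ### Differentials of functions and coordinate vectors in charts -/

section Differential

variable {n : ℕ} {N : Type*} [TopologicalSpace N] [ChartedSpace (EuclideanSpace ℝ (Fin n)) N]

variable (n) in
/-- The differential of a real-valued function. -/
noncomputable def realDifferential (f : N → ℝ) (x : N) : TangentSpace (𝓡 n) x →L[ℝ] ℝ :=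
  mfderiv (𝓡 n) 𝓘(ℝ, ℝ) f x

variable [IsManifold (𝓡 n) ∞ N]

lemma contMDiffAt_chart_symm {x₀ : N} {y : EuclideanSpace ℝ (Fin n)}
    (hy : y ∈ (chartAt (EuclideanSpace ℝ (Fin n)) x₀).target) :
    ContMDiffAt (𝓡 n) (𝓡 n) ∞ (chartAt (EuclideanSpace ℝ (Fin n)) x₀).symm y :=
  contMDiffAt_symm_of_mem_maximalAtlas (IsManifold.chart_mem_maximalAtlas x₀) hy

lemma contDiffOn_comp_chart_symm {W : Type*} [NormedAddCommGroup W] [NormedSpace ℝ W]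
    {f : N → W} (hf : ContMDiff (𝓡 n) 𝓘(ℝ, W) ∞ f) (x₀ : N) :
    ContDiffOn ℝ ∞ (fun y ↦ f ((chartAt (EuclideanSpace ℝ (Fin n)) x₀).symm y))
      (chartAt (EuclideanSpace ℝ (Fin n)) x₀).target := fun _ hy ↦
  ((hf.contMDiffAt.comp _ (contMDiffAt_chart_symm hy)).contDiffAt).contDiffWithinAt

lemma mfderiv_chartVector {W : Type*} [NormedAddCommGroup W] [NormedSpace ℝ W]
    {f : N → W} (hf : ContMDiff (𝓡 n) 𝓘(ℝ, W) ∞ f) {x₀ : N} {y : EuclideanSpace ℝ (Fin n)}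
    (hy : y ∈ (chartAt (EuclideanSpace ℝ (Fin n)) x₀).target) (v : EuclideanSpace ℝ (Fin n)) :
    mfderiv (𝓡 n) 𝓘(ℝ, W) f ((chartAt (EuclideanSpace ℝ (Fin n)) x₀).symm y)
      (chartVector x₀ y v) =
        fderiv ℝ (fun y ↦ f ((chartAt (EuclideanSpace ℝ (Fin n)) x₀).symm y)) y v := by
  have h1 : MDifferentiableAt (𝓡 n) 𝓘(ℝ, W) f ((chartAt (EuclideanSpace ℝ (Fin n)) x₀).symm y) :=
    hf.mdifferentiableAt (by simp)
  have h2 : MDifferentiableAt (𝓡 n) (𝓡 n) (chartAt (EuclideanSpace ℝ (Fin n)) x₀).symm y :=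
    (contMDiffAt_chart_symm hy).mdifferentiableAt (by simp)
  rw [← mfderiv_eq_fderiv]
  exact (mfderiv_comp_apply y h1 h2 v).symm

variable [RiemannianBundle (fun x : N ↦ TangentSpace (𝓡 n) x)]
  [IsContMDiffRiemannianBundle (𝓡 n) ∞ (EuclideanSpace ℝ (Fin n))
    (fun x : N ↦ TangentSpace (𝓡 n) x)]

variable (n N) in
lemma isContinuousRiemannianBundle_tangentSpace :
    IsContinuousRiemannianBundle (EuclideanSpace ℝ (Fin n)) (fun x : N ↦ TangentSpace (𝓡 n) x) := by
  obtain ⟨g, hg, hg'⟩ := IsContMDiffRiemannianBundle.exists_contMDiff (IB := 𝓡 n) (n := ∞)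
    (F := EuclideanSpace ℝ (Fin n)) (E := fun x : N ↦ TangentSpace (𝓡 n) x)
  exact ⟨g, hg.continuous, hg'⟩

lemma continuousOn_norm_chartVector (x₀ : N) (v : EuclideanSpace ℝ (Fin n)) :
    ContinuousOn (fun y ↦ ‖chartVector x₀ y v‖)
      (chartAt (EuclideanSpace ℝ (Fin n)) x₀).target := by
  have key : ContinuousOn (fun y ↦ (⟨_, chartVector x₀ y v⟩ : TangentBundle (𝓡 n) N))
      (chartAt (EuclideanSpace ℝ (Fin n)) x₀).target := by
    have h1 : ContMDiffOn (𝓡 n) (𝓡 n) 1 (chartAt (EuclideanSpace ℝ (Fin n)) x₀).symm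
      (chartAt (EuclideanSpace ℝ (Fin n)) x₀).target :=
        (contMDiffOn_chart_symm (I := 𝓡 n) (n := ∞)).of_le (by simp)
    have h2 := h1.continuousOn_tangentMapWithin le_rfl
      (chartAt (EuclideanSpace ℝ (Fin n)) x₀).open_target.uniqueMDiffOn
    have h3 : Continuous (fun y : EuclideanSpace ℝ (Fin n) ↦
        ((tangentBundleModelSpaceHomeomorph (𝓡 n)).symm (y, v) :
          TangentBundle (𝓡 n) (EuclideanSpace ℝ (Fin n)))) := by
      fun_prop
    refine (h2.comp h3.continuousOn (s := (chartAt (EuclideanSpace ℝ (Fin n)) x₀).target)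
      (fun y hy ↦ hy)).congr fun y hy ↦ ?_
    simp only [chartVector, tangentMapWithin, Function.comp]
    rw [mfderivWithin_of_isOpen (chartAt (EuclideanSpace ℝ (Fin n)) x₀).open_target]
    · rfl
    · exact hy
  have := isContinuousRiemannianBundle_tangentSpace n N
  simp only [norm_eq_sqrt_real_inner]
  exact Real.continuous_sqrt.comp_continuousOn (ContinuousOn.inner_bundle
    (F := EuclideanSpace ℝ (Fin n)) (E := (fun x : N ↦ TangentSpace (𝓡 n) x)) key key)

/-- Near `x₀` one has `df = d(f ∘ φ⁻¹) ∘ dφ`, and `dφ` is the tangent trivialization, whose norm for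
a continuous Riemannian metric is locally bounded by some `C`. -/
lemma norm_realDifferential_le_of_chart (x₀ : N) : ∃ C : ℝ, ∀ᶠ z in 𝓝 x₀, ∀ f : N → ℝ,
    ContMDiff (𝓡 n) 𝓘(ℝ, ℝ) ∞ f → ‖realDifferential n f z‖ ≤ C *
      ‖fderiv ℝ (fun y ↦ f ((chartAt (EuclideanSpace ℝ (Fin n)) x₀).symm y))
        (chartAt (EuclideanSpace ℝ (Fin n)) x₀ z)‖ := by
  have := isContinuousRiemannianBundle_tangentSpace n N
  obtain ⟨C, hC, hC'⟩ := eventually_norm_trivializationAt_lt (EuclideanSpace ℝ (Fin n))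
    (fun x : N ↦ TangentSpace (𝓡 n) x) x₀
  set φ := chartAt (EuclideanSpace ℝ (Fin n)) x₀
  refine ⟨C, ?_⟩
  filter_upwards [hC', φ.open_source.mem_nhds (mem_chart_source _ x₀)] with z hz hzs f hf
  refine ContinuousLinearMap.opNorm_le_bound _ (by positivity) fun v ↦ ?_
  have hd := (contMDiffAt_of_mem_maximalAtlas (n := ∞) (I := 𝓡 n)
    (IsManifold.chart_mem_maximalAtlas x₀) hzs).mdifferentiableAt (by simp)
  have hy := φ.map_source hzs
  have hg : DifferentiableAt ℝ (fun y ↦ f (φ.symm y)) (φ z) :=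
    ((contDiffOn_comp_chart_symm hf x₀).contDiffAt (φ.open_target.mem_nhds hy)).differentiableAt
      (by simp)
  obtain ⟨w, h1, h2⟩ : ∃ w : EuclideanSpace ℝ (Fin n), ‖w‖ ≤ C * ‖v‖ ∧
      realDifferential n f z v = fderiv ℝ (fun y ↦ f (φ.symm y)) (φ z) w := by
    refine ⟨mfderiv (𝓡 n) (𝓡 n) φ z v, ?_, ?_⟩
    · have h := ContinuousLinearMap.le_of_opNorm_le _ hz.le v
      rw [TangentBundle.continuousLinearMapAt_trivializationAt hzs] at h
      exact h
    · have h3 : f =ᶠ[𝓝 z] (fun y ↦ f (φ.symm y)) ∘ φ := by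
        filter_upwards [φ.open_source.mem_nhds hzs] with w hw
        simp [φ.left_inv hw]
      rw [realDifferential, h3.mfderiv_eq, ← mfderiv_eq_fderiv]
      exact mfderiv_comp_apply z hg.mdifferentiableAt hd v
  rw [h2, mul_assoc, mul_left_comm, mul_comm]
  calc _ ≤ _ := ContinuousLinearMap.le_opNorm _ _
    _ ≤ ‖fderiv ℝ (fun y ↦ f (φ.symm y)) (φ z)‖ * (C * ‖v‖) := by gcongr
    _ = _ := by ring

end Differential

/-! ### Smooth compactly supported functions as elements of `H¹_c(N)` -/

section Sobolev

variable {n : ℕ} {N : Type*} [TopologicalSpace N] [ChartedSpace (EuclideanSpace ℝ (Fin n)) N]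
  [IsManifold (𝓡 n) ∞ N]

/-- For chart representatives `g = u ∘ φ.symm`, whose values outside the chart target are
meaningless: a factor supported in the target hides them. -/
lemma continuous_mul_of_tsupport_subset {X : Type*} [TopologicalSpace X] {U : Set X}
    (hU : IsOpen U) {f g : X → ℂ} (hf : Continuous f) (hfU : tsupport f ⊆ U)
    (hg : ContinuousOn g U) : Continuous fun x ↦ f x * g x :=
  continuous_of_tsupport fun _ hx ↦ hf.continuousAt.mul
    (hg.continuousAt (hU.mem_nhds (hfU (closure_mono (Function.support_mul_subset_left f g) hx))))

/-- Integration by parts in each chart; there is no boundary term because the test function is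
compactly supported in the target. -/
lemma isWeakDifferential_differential {u : N → ℂ} (hu : ContMDiff (𝓡 n) 𝓘(ℝ, ℂ) ∞ u) :
    IsWeakDifferential u (fun x ↦ differential (n := n) u x) := by
  intro x₀
  set φ := chartAt (EuclideanSpace ℝ (Fin n)) x₀
  have hd := contDiffOn_comp_chart_symm hu x₀
  have hα (v : EuclideanSpace ℝ (Fin n)) {y : EuclideanSpace ℝ (Fin n)} (hy : y ∈ φ.target) :
      differential u (φ.symm y) (chartVector x₀ y v) = fderiv ℝ (fun y ↦ u (φ.symm y)) y v :=
    mfderiv_chartVector hu hy v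
  have hc (v : EuclideanSpace ℝ (Fin n)) :
      ContinuousOn (fun y ↦ fderiv ℝ (fun y ↦ u (φ.symm y)) y v) φ.target :=
    (hd.continuousOn_fderiv_of_isOpen φ.open_target (by simp)).clm_apply continuousOn_const
  refine ⟨hd.continuousOn.locallyIntegrableOn φ.open_target.measurableSet, fun v ↦
    ⟨((hc v).congr fun y hy ↦ hα v hy).locallyIntegrableOn φ.open_target.measurableSet,
      fun η hη hηc hηs ↦ ?_⟩⟩
  set ηc : EuclideanSpace ℝ (Fin n) → ℂ := fun y ↦ (η y : ℂ) with hηdef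
  have hηc' : ContDiff ℝ ∞ ηc := Complex.ofRealCLM.contDiff.comp hη
  have hsupp : tsupport ηc = tsupport η := by
    simp [tsupport, Function.support, hηdef]
  have hcs : HasCompactSupport ηc := by rw [HasCompactSupport, hsupp]; exact hηc
  have hfd (y : EuclideanSpace ℝ (Fin n)) : fderiv ℝ ηc y v = (fderiv ℝ η y v : ℂ) := by
    have h := Complex.ofRealCLM.hasFDerivAt.comp y
      ((hη.differentiable (by simp)) y).hasFDerivAt
    rw [show ηc = Complex.ofRealCLM ∘ η from rfl, h.fderiv]
    rfl
  have hfs : tsupport (fun y ↦ fderiv ℝ ηc y v) ⊆ tsupport ηc := tsupport_fderiv_apply_subset ℝ v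
  have hcf : Continuous fun y ↦ fderiv ℝ ηc y v :=
    (hηc'.continuous_fderiv (by simp)).clm_apply continuous_const
  have key := integral_mul_fderiv_eq_neg_fderiv_mul_of_integrable (μ := volume) (f := ηc)
    (g := fun y ↦ u (φ.symm y)) (v := v)
    ((continuous_mul_of_tsupport_subset φ.open_target hcf (hfs.trans (hsupp ▸ hηs))
      hd.continuousOn).integrable_of_hasCompactSupport
      ((hcs.mono' (subset_closure.trans hfs)).mul_right))
    ((continuous_mul_of_tsupport_subset φ.open_target hηc'.continuous (hsupp ▸ hηs)
      (hc v)).integrable_of_hasCompactSupport hcs.mul_right)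
    ((continuous_mul_of_tsupport_subset φ.open_target hηc'.continuous (hsupp ▸ hηs)
      hd.continuousOn).integrable_of_hasCompactSupport hcs.mul_right)
    (fun y _ ↦ hηc'.differentiable (by simp) y)
    (fun y hy ↦ (hd.contDiffAt (φ.open_target.mem_nhds (hηs (hsupp ▸ hy)))).differentiableAt
      (by simp))
  simp only [hfd] at key
  rw [← neg_eq_iff_eq_neg.2 key]
  congr 1
  refine integral_congr_ae (Filter.Eventually.of_forall fun y ↦ ?_)
  by_cases hy : y ∈ φ.target
  · exact congrArg (ηc y * ·) (hα v hy).symm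
  · have : η y = 0 := image_eq_zero_of_notMem_tsupport fun h ↦ hy (hηs h)
    simp [hηdef, this]

/-- Local bounds that survive enlarging the constant combine, over a finite subcover, to one bound
on a compact set. -/
lemma exists_forall_mem_of_isCompact {X : Type*} [TopologicalSpace X] {P : ℝ → X → Prop}
    (hP : ∀ C C' z, C ≤ C' → P C z → P C' z) {K : Set X} (hK : IsCompact K)
    (h : ∀ x ∈ K, ∃ C, ∀ᶠ z in 𝓝 x, P C z) : ∃ C, ∀ z ∈ K, P C z := by
  refine hK.induction_on (p := fun K ↦ ∃ C, ∀ z ∈ K, P C z) ⟨0, by simp⟩ ?_ ?_ ?_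
  · exact fun s t hst ⟨C, hC⟩ ↦ ⟨C, fun z hz ↦ hC z (hst hz)⟩
  · rintro s t ⟨C, hC⟩ ⟨C', hC'⟩
    refine ⟨max C C', fun z hz ↦ hz.elim (fun hz ↦ ?_) fun hz ↦ ?_⟩
    · exact hP _ _ _ (le_max_left _ _) (hC z hz)
    · exact hP _ _ _ (le_max_right _ _) (hC' z hz)
  · intro x hx
    obtain ⟨C, hC⟩ := h x hx
    exact ⟨_, mem_nhdsWithin_of_mem_nhds hC, C, fun z hz ↦ hz⟩

/-- Applied with `L = Re` and `L = Im`, the two real covectors that enter `sobolevNormSq`. -/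
lemma clm_comp_differential (L : ℂ →L[ℝ] ℝ) {u : N → ℂ} (hu : ContMDiff (𝓡 n) 𝓘(ℝ, ℂ) ∞ u)
    (x : N) : L ∘L differential (n := n) u x = realDifferential n (fun z ↦ L (u z)) x := by
  have hL : MDifferentiableAt 𝓘(ℝ, ℂ) 𝓘(ℝ, ℝ) L (u x) := L.differentiableAt.mdifferentiableAt
  have h := mfderiv_comp x hL (hu.mdifferentiableAt (by simp) (x := x))
  rw [mfderiv_eq_fderiv, L.fderiv] at h
  exact h.symm

lemma differential_eq_zero_of_notMem_tsupport {u : N → ℂ} {x : N} (hx : x ∉ tsupport u) :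
    differential (n := n) u x = 0 := by
  have h : u =ᶠ[𝓝 x] fun _ ↦ 0 := by
    filter_upwards [(isClosed_tsupport u).isOpen_compl.mem_nhds hx] with z hz
    exact image_eq_zero_of_notMem_tsupport hz
  rw [differential, h.mfderiv_eq]
  exact mfderiv_const

variable [RiemannianBundle (fun x : N ↦ TangentSpace (𝓡 n) x)]
  [IsContMDiffRiemannianBundle (𝓡 n) ∞ (EuclideanSpace ℝ (Fin n))
    (fun x : N ↦ TangentSpace (𝓡 n) x)]

lemma exists_eventually_norm_realDifferential_le {f : N → ℝ}
    (hf : ContMDiff (𝓡 n) 𝓘(ℝ, ℝ) ∞ f) (x₀ : N) :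
    ∃ C : ℝ, ∀ᶠ z in 𝓝 x₀, ‖realDifferential n f z‖ ≤ C := by
  set φ := chartAt (EuclideanSpace ℝ (Fin n)) x₀
  obtain ⟨C, hC⟩ := norm_realDifferential_le_of_chart (n := n) (N := N) x₀
  have h1 : ContinuousAt (fun z ↦ C * ‖fderiv ℝ (fun y ↦ f (φ.symm y)) (φ z)‖) x₀ :=
    continuousAt_const.mul (ContinuousAt.norm (ContinuousAt.comp
      (((contDiffOn_comp_chart_symm hf x₀).continuousOn_fderiv_of_isOpen φ.open_target
        (by simp)).continuousAt (φ.open_target.mem_nhds (φ.map_source (mem_chart_source _ x₀))))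
      (φ.continuousAt (mem_chart_source _ x₀))))
  refine ⟨C * ‖fderiv ℝ (fun y ↦ f (φ.symm y)) (φ x₀)‖ + 1, ?_⟩
  filter_upwards [hC, h1.eventually_lt continuousAt_const (lt_add_one _)] with z hz hz'
  exact (hz f hf).trans hz'.le

variable [T2Space N] [SigmaCompactSpace N] [MeasurableSpace N] [BorelSpace N]

/-- The `H¹` integrand is bounded on the compact support of `u`, vanishes outside it, and the
support has finite volume. -/
lemma isCompactSobolev_differential {u : N → ℂ} (hu : ContMDiff (𝓡 n) 𝓘(ℝ, ℂ) ∞ u)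
    (hc : HasCompactSupport u) : IsCompactSobolev u (fun x ↦ differential (n := n) u x) := by
  refine ⟨isWeakDifferential_differential hu, ?_, tsupport u, hc,
    Filter.Eventually.of_forall fun x ↦ image_eq_zero_of_notMem_tsupport⟩
  obtain ⟨C, hC⟩ := exists_forall_mem_of_isCompact (K := tsupport u) (P := fun C z ↦
    ‖u z‖ ^ 2 + (‖Complex.reCLM ∘L differential (n := n) u z‖ ^ 2 +
      ‖Complex.imCLM ∘L differential (n := n) u z‖ ^ 2) ≤ C) (fun C C' z h h' ↦ h'.trans h) hc
    (fun x _ ↦ by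
      obtain ⟨C₁, h₁⟩ := exists_eventually_norm_realDifferential_le (n := n)
        (Complex.reCLM.contDiff.contMDiff.comp hu) x
      obtain ⟨C₂, h₂⟩ := exists_eventually_norm_realDifferential_le (n := n)
        (Complex.imCLM.contDiff.contMDiff.comp hu) x
      refine ⟨(‖u x‖ + 1) ^ 2 + (C₁ ^ 2 + C₂ ^ 2), ?_⟩
      filter_upwards [h₁, h₂, hu.continuous.norm.continuousAt.eventually_lt continuousAt_const
        (lt_add_one _)] with z hz₁ hz₂ hz
      rw [clm_comp_differential _ hu, clm_comp_differential _ hu]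
      gcongr
      · exact hz₁
      · exact hz₂)
  calc sobolevNormSq u (fun x ↦ differential (n := n) u x)
      ≤ ∫⁻ x, (tsupport u).indicator (fun _ ↦ ENNReal.ofReal C) x ∂(riemannianVolume n N) := by
        refine lintegral_mono fun x ↦ ?_
        by_cases hx : x ∈ tsupport u
        · rw [indicator_of_mem hx]
          exact ENNReal.ofReal_le_ofReal (hC x hx)
        · beta_reduce
          rw [indicator_of_notMem hx, differential_eq_zero_of_notMem_tsupport hx,
            image_eq_zero_of_notMem_tsupport hx]
          have h0 (L : ℂ →L[ℝ] ℝ) : ‖L ∘L (0 : TangentSpace (𝓡 n) x →L[ℝ] ℂ)‖ = 0 := by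
            rw [ContinuousLinearMap.comp_zero]
            exact ContinuousLinearMap.opNorm_zero
          rw [h0, h0]
          simp
    _ = ENNReal.ofReal C * riemannianVolume n N (tsupport u) :=
        lintegral_indicator_const (isClosed_tsupport u).measurableSet _
    _ < ⊤ := ENNReal.mul_lt_top ENNReal.ofReal_lt_top hc.measure_lt_top

end Sobolev

/-! ### Pointwise estimate of the commutator of `D` with a function -/

section Commutator

variable {n : ℕ} {N : Type*} [TopologicalSpace N] [ChartedSpace (EuclideanSpace ℝ (Fin n)) N]
  [T2Space N] [IsManifold (𝓡 n) ∞ N]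
  [RiemannianBundle (fun x : N ↦ TangentSpace (𝓡 n) x)]
  [IsContMDiffRiemannianBundle (𝓡 n) ∞ (EuclideanSpace ℝ (Fin n))
    (fun x : N ↦ TangentSpace (𝓡 n) x)]
  {F : Type*} [NormedAddCommGroup F] [NormedSpace ℂ F]
  {V : N → Type*} [TopologicalSpace (TotalSpace F V)] [∀ x, NormedAddCommGroup (V x)]
  [∀ x, InnerProductSpace ℂ (V x)] [FiberBundle F V] [VectorBundle ℂ F V] [VectorBundle ℝ F V]
  [IsSmoothHermitianBundle n F V]

lemma abs_fderiv_comp_chart_symm_le {f : N → ℝ} (hf : ContMDiff (𝓡 n) 𝓘(ℝ, ℝ) ∞ f) {x₀ z : N}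
    (hz : z ∈ (chartAt (EuclideanSpace ℝ (Fin n)) x₀).source) (v : EuclideanSpace ℝ (Fin n)) :
    |fderiv ℝ (fun y ↦ f ((chartAt (EuclideanSpace ℝ (Fin n)) x₀).symm y))
      (chartAt (EuclideanSpace ℝ (Fin n)) x₀ z) v| ≤ ‖realDifferential n f z‖ *
        ‖chartVector x₀ (chartAt (EuclideanSpace ℝ (Fin n)) x₀ z) v‖ := by
  set φ := chartAt (EuclideanSpace ℝ (Fin n)) x₀
  have h1 : ‖realDifferential n f (φ.symm (φ z))‖ = ‖realDifferential n f z‖ := by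
    rw [φ.left_inv hz]
  rw [← mfderiv_chartVector hf (φ.map_source hz), ← h1]
  exact ContinuousLinearMap.le_opNorm (realDifferential n f (φ.symm (φ z))) _

lemma SmoothAlongAt.continuousAt_norm {s : ∀ x, V x} {x : N}
    (hs : SmoothAlongAt n F (𝓡 n) (id : N → N) s x) : ContinuousAt (fun z ↦ ‖s z‖) x := by
  have h := (Complex.continuous_re.continuousAt.comp
    (SmoothAlongAt.continuousAt_inner (f := (id : N → N)) hs hs)).sqrt
  refine h.congr (Filter.Eventually.of_forall fun z ↦ ?_)
  exact (norm_eq_sqrt_re_inner (𝕜 := ℂ) (s z)).symm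

lemma contDiffAt_sectionInCoord (s : SmoothSections n F V) (x₀ : N) :
    ContDiffAt ℝ ∞ (sectionInCoord n F x₀ s.1) (chartAt (EuclideanSpace ℝ (Fin n)) x₀ x₀) := by
  have h1 := (smoothAlongAt_iff.1 (show SmoothAlongAt n F (𝓡 n) (id : N → N) s.1 x₀
    from s.2 x₀)).2
  exact (h1.comp_of_eq (contMDiffAt_chart_symm
    ((chartAt _ x₀).map_source (mem_chart_source _ x₀))) (by simp)).contDiffAt

/-- By the product rule `[D, f] s = ∑ᵢ ∂ᵢf · tᵢ`, where the sections `tᵢ = σ_D(dxᵢ) s` do not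
involve `f`, and `|∂ᵢf|` is at most `|df|` times the length of the `i`-th coordinate vector. The
constant must not depend on `f`, since `f` will run through an approximation in `H¹`. -/
lemma exists_eventually_norm_commutator_le (D : FirstOrderDiffOp n F V) (s : SmoothSections n F V)
    (x₀ : N) : ∃ C : ℝ, ∀ᶠ z in 𝓝 x₀, ∀ f : C^∞⟮𝓡 n, N; 𝓘(ℝ, ℝ), ℝ⟯,
      ‖(D.toLinearMap (mulSection f s)).1 z - (f z : ℂ) • (D.toLinearMap s).1 z‖ ≤
        C * ‖realDifferential n f z‖ := by
  obtain ⟨P, Q, hP, -, hD⟩ := D.exists_coord x₀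
  set φ := chartAt (EuclideanSpace ℝ (Fin n)) x₀
  set e := trivializationAt F V x₀
  set σ := sectionInCoord n F x₀ s.1
  have hxs : x₀ ∈ φ.source := mem_chart_source _ x₀
  have hxb : x₀ ∈ e.baseSet := FiberBundle.mem_baseSet_trivializationAt' x₀
  have hy : φ x₀ ∈ coordDomain n F V x₀ := chart_mem_coordDomain hxs hxb
  have hσ : ContDiffAt ℝ ∞ σ (φ x₀) := contDiffAt_sectionInCoord s x₀
  have hφ : ContMDiffAt (𝓡 n) (𝓡 n) ∞ φ x₀ := contMDiffAt_of_mem_maximalAtlas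
    (IsManifold.chart_mem_maximalAtlas x₀) hxs
  let ℓ (i : Fin n) : EuclideanSpace ℝ (Fin n) →L[ℝ] ℝ := EuclideanSpace.proj i
  let b (i : Fin n) : EuclideanSpace ℝ (Fin n) := EuclideanSpace.basisFun (Fin n) ℝ i
  -- The symbol of `dxᵢ` applied to `s`, in coordinates; `t i` is the same section in the fibres of
  -- `V`. As `t i` is smooth at `x₀`, its hermitian norm is continuous there, so no comparison
  -- between the norms of `F` and `V` is needed.
  let τ (i : Fin n) (y : EuclideanSpace ℝ (Fin n)) : F := P y ((ℓ i).smulRight (σ y))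
  let t (i : Fin n) (z : N) : V z := e.symm z (τ i (φ z))
  have ht (i : Fin n) : SmoothAlongAt n F (𝓡 n) (id : N → N) (t i) x₀ := by
    have hτ : ContDiffAt ℝ ∞ (τ i) (φ x₀) :=
      (hP.contDiffAt ((isOpen_coordDomain x₀).mem_nhds hy)).clm_apply
        ((ContinuousLinearMap.smulRightL ℝ (EuclideanSpace ℝ (Fin n)) F
          (ℓ i)).contDiff.contDiffAt.comp _ hσ)
    refine smoothAlongAt_iff.2 ⟨contMDiffAt_id, (hτ.contMDiffAt.comp x₀ hφ).congr_of_eventuallyEq ?_⟩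
    filter_upwards [e.open_baseSet.mem_nhds hxb] with z hz
    exact congrArg Prod.snd (e.apply_mk_symm hz _)
  have hcv (i : Fin n) : ContinuousAt (fun z ↦ ‖chartVector x₀ (φ z) (b i)‖) x₀ :=
    ContinuousAt.comp (f := φ) (g := fun y ↦ ‖chartVector x₀ y (b i)‖)
      ((continuousOn_norm_chartVector x₀ (b i)).continuousAt
        (φ.open_target.mem_nhds (φ.map_source hxs))) (φ.continuousAt hxs)
  let C (i : Fin n) (z : N) : ℝ := ‖chartVector x₀ (φ z) (b i)‖ * ‖t i z‖
  have hC : ContinuousAt (fun z ↦ ∑ i, C i z) x₀ :=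
    tendsto_finsetSum _ fun i _ ↦ (hcv i).mul (ht i).continuousAt_norm
  have hdiff : ∀ᶠ y in 𝓝 (φ x₀), DifferentiableAt ℝ σ y :=
    ((hσ.of_le (m := 1) (by simp)).eventually (by simp)).mono
      fun y hy ↦ hy.differentiableAt (by simp)
  refine ⟨∑ i, C i x₀ + 1, ?_⟩
  filter_upwards [hC.eventually_lt continuousAt_const (lt_add_one _), φ.open_source.mem_nhds hxs,
    e.open_baseSet.mem_nhds hxb, (φ.continuousAt hxs).eventually hdiff] with z hCz hzs hzb hzd f
  have hf : ContMDiff (𝓡 n) 𝓘(ℝ, ℝ) ∞ f := f.contMDiff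
  set g : EuclideanSpace ℝ (Fin n) → ℝ := fun y ↦ f (φ.symm y) with hg
  have hgd : DifferentiableAt ℝ g (φ z) :=
    ((contDiffOn_comp_chart_symm hf x₀).contDiffAt (φ.open_target.mem_nhds
      (φ.map_source hzs))).differentiableAt (by simp)
  have hgz : g (φ z) = f z := congrArg f (φ.left_inv hzs)
  have hyz : φ z ∈ coordDomain n F V x₀ := chart_mem_coordDomain hzs hzb
  have hmul : sectionInCoord n F x₀ (mulSection f s).1 =ᶠ[𝓝 (φ z)] fun y ↦ g y • σ y := by
    filter_upwards [(isOpen_coordDomain x₀).mem_nhds hyz] with y hy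
    exact ((e.linear ℂ hy.2).map_smul _ _).trans (Complex.coe_smul _ _)
  -- The product rule, with the term `dg ⊗ σ` expanded in the dual basis so that the scalars `∂ᵢg`
  -- can be pulled out of `P`.
  have hfd : fderiv ℝ (fun y ↦ g y • σ y) (φ z) =
      f z • fderiv ℝ σ (φ z) + ∑ i, (fderiv ℝ g (φ z) (b i)) • (ℓ i).smulRight (σ (φ z)) := by
    rw [fderiv_fun_smul hgd hzd, hgz]
    congr 1
    ext v
    have hv : v = ∑ i, ℓ i v • b i := by
      simpa [ℓ, b] using ((EuclideanSpace.basisFun (Fin n) ℝ).sum_repr v).symm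
    conv_lhs => rw [hv]
    simp [smul_smul, mul_comm]
  let E := e.continuousLinearEquivAt ℂ z hzb
  have hE (v : V z) : E v = (e (TotalSpace.mk' F z v)).2 := rfl
  -- The term with `Q` and the term `f P(dσ)` cancel against `f D s`; only the symbol part survives.
  have hmain : (D.toLinearMap (mulSection f s)).1 z - (f z : ℂ) • (D.toLinearMap s).1 z =
      ∑ i, (fderiv ℝ g (φ z) (b i) : ℂ) • t i z := by
    apply E.injective
    have h1 := hD (mulSection f s) _ hyz
    rw [hmul.fderiv_eq, hmul.eq_of_nhds, hfd, sectionInCoord_chart hzs] at h1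
    have h2 := hD s _ hyz
    rw [sectionInCoord_chart hzs] at h2
    have h3 (i : Fin n) : E ((fderiv ℝ g (φ z) (b i) : ℂ) • t i z) =
        fderiv ℝ g (φ z) (b i) • τ i (φ z) := by
      rw [map_smul, Complex.coe_smul]
      exact congrArg _ (congrArg Prod.snd (e.apply_mk_symm hzb _))
    rw [map_sub, map_smul, map_sum, Finset.sum_congr rfl fun i _ ↦ h3 i, hE, hE, h1, h2]
    simp only [map_add, map_sum, map_smul, Complex.coe_smul, hgz, smul_add]
    simp [τ, σ]
  rw [hmain]
  calc _ ≤ ∑ i, ‖(fderiv ℝ g (φ z) (b i) : ℂ) • t i z‖ := norm_sum_le _ _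
    _ ≤ ∑ i, ‖realDifferential n f z‖ * C i z := by
      refine Finset.sum_le_sum fun i _ ↦ ?_
      rw [norm_smul, Complex.norm_real, Real.norm_eq_abs, ← mul_assoc]
      exact mul_le_mul_of_nonneg_right (abs_fderiv_comp_chart_symm_le hf hzs _) (norm_nonneg _)
    _ = (∑ i, C i z) * ‖realDifferential n f z‖ := by rw [← Finset.mul_sum, mul_comm]
    _ ≤ _ := mul_le_mul_of_nonneg_right hCz.le (ContinuousLinearMap.opNorm_nonneg _)

end Commutator

/-! ### Graph-norm approximation by sections supported in `U₀` -/

section Approximation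

variable {n : ℕ} {N : Type*} [TopologicalSpace N] [ChartedSpace (EuclideanSpace ℝ (Fin n)) N]
  [T2Space N] [SigmaCompactSpace N] [IsManifold (𝓡 n) ∞ N] [MeasurableSpace N] [BorelSpace N]
  [RiemannianBundle (fun x : N ↦ TangentSpace (𝓡 n) x)]
  [IsContMDiffRiemannianBundle (𝓡 n) ∞ (EuclideanSpace ℝ (Fin n))
    (fun x : N ↦ TangentSpace (𝓡 n) x)]
  {F : Type*} [NormedAddCommGroup F] [NormedSpace ℂ F]
  {V : N → Type*} [TopologicalSpace (TotalSpace F V)] [∀ x, NormedAddCommGroup (V x)]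
  [∀ x, InnerProductSpace ℂ (V x)] [FiberBundle F V] [VectorBundle ℂ F V] [VectorBundle ℝ F V]
  [IsSmoothHermitianBundle n F V]

lemma FirstOrderDiffOp.eq_zero_of_notMem_sectionSupport (D : FirstOrderDiffOp n F V)
    (s : SmoothSections n F V) {x : N} (hx : x ∉ sectionSupport s.1) :
    (D.toLinearMap s).1 x = 0 := by
  refine D.eq_zero_of_eventually s x ?_
  filter_upwards [isClosed_closure.isOpen_compl.mem_nhds hx] with z hz
  exact _root_.eq_zero_of_notMem_sectionSupport hz

/-- The operator `D` on the compactly supported smooth sections over `U`. -/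
def FirstOrderDiffOp.onTestSections (D : FirstOrderDiffOp n F V) (U : Set N) :
    TestSections n F V U →ₗ[ℂ] TestSections n F V U where
  toFun s := ⟨(D.toLinearMap ⟨s.1, s.2.1⟩).1, by
    have h : sectionSupport (D.toLinearMap ⟨s.1, s.2.1⟩).1 ⊆ sectionSupport s.1 :=
      closure_minimal (fun x hx ↦ by
        by_contra hn
        exact hx (D.eq_zero_of_notMem_sectionSupport ⟨s.1, s.2.1⟩ hn)) isClosed_closure
    exact ⟨(D.toLinearMap ⟨s.1, s.2.1⟩).2, s.2.2.1.of_isClosed_subset isClosed_closure h,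
      h.trans s.2.2.2⟩⟩
  map_add' s t := by
    have h := congrArg (fun r : SmoothSections n F V ↦ r.1)
      (D.toLinearMap.map_add (⟨s.1, s.2.1⟩ : SmoothSections n F V) ⟨t.1, t.2.1⟩)
    exact Subtype.ext h
  map_smul' c s := by
    have h := congrArg (fun r : SmoothSections n F V ↦ r.1)
      (D.toLinearMap.map_smul c (⟨s.1, s.2.1⟩ : SmoothSections n F V))
    exact Subtype.ext h

lemma FirstOrderDiffOp.IsSymmetric.inner_onTestSections {D : FirstOrderDiffOp n F V}
    (hD : D.IsSymmetric) {U : Set N} (s t : TestSections n F V U) :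
    inner ℂ (D.onTestSections U s) t = inner ℂ s (D.onTestSections U t) :=
  hD ⟨s.1, s.2.1⟩ ⟨t.1, t.2.1⟩ s.2.2.1 t.2.2.1

variable (n F V) in
/-- Extension by zero of compactly supported sections. -/
noncomputable def testInclusion {U U' : Set N} (h : U ⊆ U') : TestSections n F V U →ₗᵢ[ℂ] TestSections n F V U' :=
  LinearMap.isometryOfInner
    { toFun := fun s ↦ ⟨s.1, s.2.1, s.2.2.1, s.2.2.2.trans h⟩
      map_add' := fun _ _ ↦ rfl
      map_smul' := fun _ _ ↦ rfl }
    (fun _ _ ↦ rfl)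

/-- Rewrites the `L²` norm as a Lebesgue integral in `ENNReal`, the form in which the `H¹` norm is
given. -/
lemma norm_sq_testSections {U : Set N} (s : TestSections n F V U) :
    ENNReal.ofReal (‖s‖ ^ 2) = ∫⁻ x, ENNReal.ofReal (‖s.1 x‖ ^ 2) ∂(riemannianVolume n N) := by
  have h (x : N) : inner ℂ (s.1 x) (s.1 x) = ((‖s.1 x‖ ^ 2 : ℝ) : ℂ) := by
    rw [inner_self_eq_norm_sq_to_K]; simp
  have hi := (integrable_inner_section s.2 s.2).re
  have h1 : ‖s‖ ^ 2 = ∫ x, ‖s.1 x‖ ^ 2 ∂(riemannianVolume n N) := by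
    have h2 := inner_self_eq_norm_sq_to_K (𝕜 := ℂ) s
    rw [testSections_inner] at h2
    simp only [h] at h2
    rw [integral_complex_ofReal] at h2
    exact Complex.ofReal_injective (by simpa using h2.symm)
  rw [h1, ofReal_integral_eq_lintegral_ofReal]
  · exact hi.congr (Filter.Eventually.of_forall fun x ↦ inner_self_eq_norm_sq (𝕜 := ℂ) (s.1 x))
  · exact Filter.Eventually.of_forall fun x ↦ by positivity

/-- Integrates a pointwise bound. Monotonicity and pulling out a finite constant need no
measurability of `h`, so `h` may be the `H¹` density itself. -/
lemma norm_lt_of_sq_le_mul {U : Set N} {s : TestSections n F V U} {A δ ε : ℝ} (hA : 0 ≤ A)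
    (hε : 0 < ε) (hδ : A * δ < ε ^ 2) {h : N → ℝ} (hs : ∀ x, ‖s.1 x‖ ^ 2 ≤ A * h x)
    (hh : ∫⁻ x, ENNReal.ofReal (h x) ∂(riemannianVolume n N) ≤ ENNReal.ofReal δ) : ‖s‖ < ε := by
  refine lt_of_pow_lt_pow_left₀ 2 hε.le ((ENNReal.ofReal_lt_ofReal_iff (by positivity)).1 ?_)
  calc ENNReal.ofReal (‖s‖ ^ 2)
      ≤ ∫⁻ x, ENNReal.ofReal A * ENNReal.ofReal (h x) ∂(riemannianVolume n N) := by
        rw [norm_sq_testSections]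
        refine lintegral_mono fun x ↦ ?_
        rw [← ENNReal.ofReal_mul hA]
        exact ENNReal.ofReal_le_ofReal (hs x)
    _ = ENNReal.ofReal A * ∫⁻ x, ENNReal.ofReal (h x) ∂(riemannianVolume n N) :=
        lintegral_const_mul' _ _ ENNReal.ofReal_ne_top
    _ ≤ ENNReal.ofReal A * ENNReal.ofReal δ := by gcongr
    _ = ENNReal.ofReal (A * δ) := (ENNReal.ofReal_mul hA).symm
    _ < ENNReal.ofReal (ε ^ 2) := (ENNReal.ofReal_lt_ofReal_iff (by positivity)).2 hδ

/-- `D (f s) = f D s + [D, f] s`, with `s`, `D s` and the commutator constant all bounded on the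
compact support of `s`; off the support both sections vanish by locality. Again `C` serves every
`f`. -/
lemma FirstOrderDiffOp.exists_bound (D : FirstOrderDiffOp n F V) (s : SmoothSections n F V)
    (hs : IsCompact (sectionSupport s.1)) :
    ∃ C : ℝ, 0 ≤ C ∧ ∀ (f : C^∞⟮𝓡 n, N; 𝓘(ℝ, ℝ), ℝ⟯) (x : N), ‖(mulSection f s).1 x‖ ≤ C * |f x| ∧
      ‖(D.toLinearMap (mulSection f s)).1 x‖ ≤ C * (|f x| + ‖realDifferential n f x‖) := by
  obtain ⟨C, hC⟩ := exists_forall_mem_of_isCompact (P := fun C z ↦ 0 ≤ C ∧ ‖s.1 z‖ ≤ C ∧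
      ‖(D.toLinearMap s).1 z‖ ≤ C ∧ ∀ f : C^∞⟮𝓡 n, N; 𝓘(ℝ, ℝ), ℝ⟯,
      ‖(D.toLinearMap (mulSection f s)).1 z - (f z : ℂ) • (D.toLinearMap s).1 z‖ ≤
        C * ‖realDifferential n f z‖) (fun C C' z h ⟨h0, h1, h2, h3⟩ ↦
      ⟨h0.trans h, h1.trans h, h2.trans h, fun f ↦ (h3 f).trans
        (mul_le_mul_of_nonneg_right h (ContinuousLinearMap.opNorm_nonneg _))⟩) hs (fun x _ ↦ by
    obtain ⟨C, hC⟩ := exists_eventually_norm_commutator_le D s x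
    have h1 (s : SmoothSections n F V) := (SmoothAlongAt.continuousAt_norm (F := F) (n := n)
      (s.2 x)).eventually_lt continuousAt_const (lt_add_one _)
    refine ⟨max C (max (‖s.1 x‖ + 1) (‖(D.toLinearMap s).1 x‖ + 1)), ?_⟩
    filter_upwards [hC, h1 s, h1 (D.toLinearMap s)] with z hz hz1 hz2
    refine ⟨?_, hz1.le.trans (by simp), hz2.le.trans (by simp), fun f ↦ (hz f).trans
      (mul_le_mul_of_nonneg_right (by simp) (ContinuousLinearMap.opNorm_nonneg _))⟩
    exact ((norm_nonneg _).trans hz1.le).trans (by simp))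
  have hmul (f : C^∞⟮𝓡 n, N; 𝓘(ℝ, ℝ), ℝ⟯) (x : N) : ‖(mulSection f s).1 x‖ = |f x| * ‖s.1 x‖ := by
    change ‖(f x : ℂ) • s.1 x‖ = _
    rw [norm_smul, Complex.norm_real, Real.norm_eq_abs]
  -- Nonnegativity of `C` is known only at points of the support, which may be empty.
  refine ⟨max C 0, le_max_right _ _, fun f x ↦ ?_⟩
  by_cases hx : x ∈ sectionSupport s.1
  · obtain ⟨h0, h1, h2, h3⟩ := hC x hx
    rw [max_eq_left h0]
    refine ⟨by rw [hmul, mul_comm]; gcongr, ?_⟩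
    calc _ = ‖(f x : ℂ) • (D.toLinearMap s).1 x + ((D.toLinearMap (mulSection f s)).1 x -
          (f x : ℂ) • (D.toLinearMap s).1 x)‖ := by rw [add_sub_cancel]
      _ ≤ |f x| * C + C * ‖realDifferential n f x‖ := by
        refine (norm_add_le _ _).trans (add_le_add ?_ (h3 f))
        rw [norm_smul, Complex.norm_real, Real.norm_eq_abs]
        gcongr
      _ = _ := by ring
  · have hx' : x ∉ sectionSupport (mulSection f s).1 := fun h ↦ hx
      (sectionSupport_mono (fun z hz ↦ by simp [mulSection, hz]) h)
    have h0 : 0 ≤ ‖realDifferential n f x‖ := ContinuousLinearMap.opNorm_nonneg _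
    rw [D.eq_zero_of_notMem_sectionSupport _ hx', _root_.eq_zero_of_notMem_sectionSupport hx',
      norm_zero]
    constructor <;> positivity

/-- The analytic core: density of functions in `H¹` becomes density of sections in the graph norm.
With `u = 1` on the support of `s` and `χ ∈ C_c^∞(U₀)` near `u`, the section `t = Re(χ) s` is the
approximation. -/
lemma exists_testSections_approx {U₀ U : Set N} (hdense : DenseInCompactSobolev n N U₀)
    (hU : U₀ ⊆ U) (D : FirstOrderDiffOp n F V) (s : TestSections n F V U) {ε : ℝ} (hε : 0 < ε) :
    ∃ t : TestSections n F V U₀, ‖s - testInclusion n F V hU t‖ < ε ∧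
      ‖D.onTestSections U s - testInclusion n F V hU (D.onTestSections U₀ t)‖ < ε := by
  have : LocallyCompactSpace N := Manifold.locallyCompact_of_finiteDimensional (𝓡 n)
  let s' : SmoothSections n F V := ⟨s.1, s.2.1⟩
  obtain ⟨C, hC0, hC⟩ := D.exists_bound s' s.2.2.1
  obtain ⟨K, hK, hsK⟩ := exists_compact_superset s.2.2.1
  obtain ⟨u, hu1, hu0, -⟩ := exists_contMDiffMap_one_nhds_of_subset_interior (n := ⊤) (𝓡 n)
    s.2.2.1.isClosed hsK
  have hu : ContMDiff (𝓡 n) 𝓘(ℝ, ℂ) ∞ (fun x ↦ (u x : ℂ)) :=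
    Complex.ofRealCLM.contDiff.contMDiff.comp u.contMDiff
  have huc : HasCompactSupport (fun x ↦ (u x : ℂ)) :=
    HasCompactSupport.intro hK fun x hx ↦ by simp [hu0 x hx]
  -- From `(C (a + b))² ≤ 2 C² (a² + b²)`, with `C` the bound of `exists_bound`. The tolerance `ε² /
  -- (A + 1)` for the `H¹` norm then gives less than `ε²`, also when `A = 0`.
  set A : ℝ := 2 * C ^ 2
  have hA : 0 ≤ A := by positivity
  have hδ : A * (ε ^ 2 / (A + 1)) < ε ^ 2 := by
    rw [mul_div_assoc', div_lt_iff₀ (by positivity)]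
    nlinarith [pow_pos hε 2]
  obtain ⟨χ, hχ, -, hχU, hχε⟩ := hdense _ _ (isCompactSobolev_differential hu huc)
    (ENNReal.ofReal (ε ^ 2 / (A + 1))) (by simp; positivity)
  set w : N → ℂ := (fun x ↦ (u x : ℂ)) - χ with hw
  have hws : ContMDiff (𝓡 n) 𝓘(ℝ, ℂ) ∞ w := hu.sub hχ
  -- The estimates concern real multipliers. As `u` is real, replacing `χ` by its real part only
  -- decreases the `H¹` distance to `u`.
  let f : C^∞⟮𝓡 n, N; 𝓘(ℝ, ℝ), ℝ⟯ := ⟨fun x ↦ (w x).re, Complex.reCLM.contDiff.contMDiff.comp hws⟩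
  let a : C^∞⟮𝓡 n, N; 𝓘(ℝ, ℝ), ℝ⟯ := ⟨fun x ↦ (χ x).re, Complex.reCLM.contDiff.contMDiff.comp hχ⟩
  have hsupp : sectionSupport (mulSection a s').1 ⊆ sectionSupport s'.1 :=
    sectionSupport_mono fun z hz ↦ by simp [mulSection, hz]
  have hsupp' : sectionSupport (mulSection a s').1 ⊆ tsupport χ := closure_mono fun z hz h ↦ hz (by
    change (((χ z).re : ℝ) : ℂ) • s.1 z = 0
    rw [h, Complex.zero_re, Complex.ofReal_zero, zero_smul])
  let t : TestSections n F V U₀ := ⟨(mulSection a s').1, (mulSection a s').2,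
    s.2.2.1.of_isClosed_subset isClosed_closure hsupp, hsupp'.trans hχU⟩
  -- Here `u = 1` on the support of `s` is used: the error `s - t` is `Re(u - χ) s`.
  have hfs : mulSection f s' = s' - mulSection a s' := by
    refine Subtype.ext (funext fun x ↦ ?_)
    change (((w x).re : ℝ) : ℂ) • s.1 x = s.1 x - (((χ x).re : ℝ) : ℂ) • s.1 x
    by_cases hx : x ∈ sectionSupport s.1
    · have : u x = 1 := hu1.self_of_nhdsSet x hx
      simp [hw, this, sub_smul]
    · simp [_root_.eq_zero_of_notMem_sectionSupport hx]
  set h : N → ℝ := fun x ↦ ‖w x‖ ^ 2 + (‖Complex.reCLM ∘L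
    (differential (n := n) (fun x ↦ (u x : ℂ)) x - differential χ x)‖ ^ 2 + ‖Complex.imCLM ∘L
    (differential (n := n) (fun x ↦ (u x : ℂ)) x - differential χ x)‖ ^ 2) with hh
  have hdf (x : N) : Complex.reCLM ∘L
      (differential (n := n) (fun x ↦ (u x : ℂ)) x - differential χ x) = realDifferential n f x := by
    have h1 : differential (n := n) w x =
        differential (n := n) (fun x ↦ (u x : ℂ)) x - differential χ x :=
      mfderiv_sub (hu.mdifferentiableAt (by simp)) (hχ.mdifferentiableAt (by simp))
    rw [← h1, clm_comp_differential _ hws]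
    rfl
  have hfh (x : N) : (C * (|f x| + ‖realDifferential n f x‖)) ^ 2 ≤ A * h x := by
    have h1 : |f x| ≤ ‖w x‖ := Complex.abs_re_le_norm (w x)
    have h2 : |f x| ^ 2 ≤ ‖w x‖ ^ 2 := by gcongr
    have h3 : |f x| ^ 2 + ‖realDifferential n f x‖ ^ 2 ≤ h x := by
      rw [hh, ← hdf]
      beta_reduce
      nlinarith [sq_nonneg ‖Complex.imCLM ∘L
        (differential (n := n) (fun x ↦ (u x : ℂ)) x - differential χ x)‖]
    calc _ = C ^ 2 * (|f x| + ‖realDifferential n f x‖) ^ 2 := by ring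
      _ ≤ C ^ 2 * (2 * (|f x| ^ 2 + ‖realDifferential n f x‖ ^ 2)) := by
        gcongr
        exact add_sq_le
      _ ≤ C ^ 2 * (2 * h x) := by gcongr
      _ = A * h x := by ring
  refine ⟨t, norm_lt_of_sq_le_mul hA hε hδ (fun x ↦ ?_) hχε.le,
    norm_lt_of_sq_le_mul hA hε hδ (fun x ↦ ?_) hχε.le⟩
  · have e : (s - testInclusion n F V hU t).1 = (mulSection f s').1 := (congrArg Subtype.val hfs).symm
    rw [e]
    refine le_trans ?_ (hfh x)
    gcongr
    refine (hC f x).1.trans ?_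
    gcongr
    exact le_add_of_nonneg_right (ContinuousLinearMap.opNorm_nonneg _)
  · have e : (D.onTestSections U s - testInclusion n F V hU (D.onTestSections U₀ t)).1 =
        (D.toLinearMap (mulSection f s')).1 := by
      rw [hfs, map_sub]
      rfl
    rw [e]
    refine le_trans ?_ (hfh x)
    gcongr
    exact (hC f x).2

end Approximation

/-! ### Solving `(1 + T⋆T) x = w` in a Hilbert space -/

section GraphProjection

/-- Orthogonal projection of `(w, 0)` to the closure of a graph `G` solves `(1 + T⋆T) x = w`. -/
lemma exists_mem_topologicalClosure_inner_eq {H : Type*} [NormedAddCommGroup H]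
    [InnerProductSpace ℂ H] [CompleteSpace H] (G : Submodule ℂ (H × H)) (w : H) :
    ∃ p ∈ G.topologicalClosure, ∀ q ∈ G.topologicalClosure,
      inner ℂ q.2 p.2 = inner ℂ q.1 (w - p.1) := by
  -- The product `H × H` carries the sup norm; orthogonal projection needs the equivalent Hilbert
  -- norm.
  let e := WithLp.prodContinuousLinearEquiv 2 ℂ H H
  let K : Submodule ℂ (WithLp 2 (H × H)) := G.topologicalClosure.comap e.toLinearMap
  have hK : IsClosed (K : Set (WithLp 2 (H × H))) :=
    (Submodule.isClosed_topologicalClosure G).preimage e.continuous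
  have : CompleteSpace K := hK.completeSpace_coe
  let v : WithLp 2 (H × H) := WithLp.toLp 2 (w, 0)
  refine ⟨e (K.starProjection v), K.starProjection_apply_mem v, fun q hq ↦ ?_⟩
  have h := Submodule.starProjection_inner_eq_zero (K := K) v (WithLp.toLp 2 q) hq
  rw [← inner_conj_symm, map_eq_zero, WithLp.prod_inner_apply] at h
  -- Orthogonality of `(w, 0) - p` to `q` is precisely the adjoint relation: `w - p.1` plays the
  -- role of `T⋆ p.2`.
  have h' : inner ℂ q.1 (w - (e (K.starProjection v)).1) +
    inner ℂ q.2 (0 - (e (K.starProjection v)).2) = 0 := h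
  rw [zero_sub, inner_neg_right, add_neg_eq_zero] at h'
  exact h'.symm

end GraphProjection

/-! ### Extension by zero and elementary tensors in the Hilbert module -/

section Module

variable {n : ℕ} {N : Type*} [TopologicalSpace N] [ChartedSpace (EuclideanSpace ℝ (Fin n)) N]
  [T2Space N] [SigmaCompactSpace N] [IsManifold (𝓡 n) ∞ N] [MeasurableSpace N] [BorelSpace N]
  [RiemannianBundle (fun x : N ↦ TangentSpace (𝓡 n) x)]
  [IsContMDiffRiemannianBundle (𝓡 n) ∞ (EuclideanSpace ℝ (Fin n))
    (fun x : N ↦ TangentSpace (𝓡 n) x)]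
  {F : Type*} [NormedAddCommGroup F] [NormedSpace ℂ F]
  {V : N → Type*} [TopologicalSpace (TotalSpace F V)] [∀ x, NormedAddCommGroup (V x)]
  [∀ x, InnerProductSpace ℂ (V x)] [FiberBundle F V] [VectorBundle ℂ F V] [VectorBundle ℝ F V]
  [IsSmoothHermitianBundle n F V]

variable (n F V) in
/-- Extension by zero of square-integrable sections. -/
noncomputable def l2Inclusion {U U' : Set N} (h : U ⊆ U') : SectionsL2 n F V U →ₗᵢ[ℂ] SectionsL2 n F V U' :=
  let f : TestSections n F V U →L[ℂ] SectionsL2 n F V U' :=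
    (UniformSpace.Completion.toComplL (𝕜 := ℂ)).comp
      (testInclusion n F V h).toContinuousLinearMap
  { toLinearMap := (f.extend (UniformSpace.Completion.toComplL (𝕜 := ℂ))).toLinearMap
    norm_map' := fun s ↦ by
      induction s using UniformSpace.Completion.induction_on with
      | hp => exact isClosed_eq (ContinuousLinearMap.continuous _).norm continuous_norm
      | ih s =>
        have h1 := f.extend_eq (e := UniformSpace.Completion.toComplL (𝕜 := ℂ))
          UniformSpace.Completion.denseRange_coe
          (UniformSpace.Completion.isUniformInducing_coe _) s
        refine (congrArg norm h1).trans ?_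
        change ‖((testInclusion n F V h s : TestSections n F V U') : SectionsL2 n F V U')‖ = _
        rw [UniformSpace.Completion.norm_coe, LinearIsometry.norm_map,
          UniformSpace.Completion.norm_coe] }

lemma l2Inclusion_coe {U U' : Set N} (h : U ⊆ U') (s : TestSections n F V U) :
    l2Inclusion n F V h (s : SectionsL2 n F V U) =
      ((testInclusion n F V h s : TestSections n F V U') : SectionsL2 n F V U') :=
  ContinuousLinearMap.extend_eq _ (e := UniformSpace.Completion.toComplL (𝕜 := ℂ))
    UniformSpace.Completion.denseRange_coe (UniformSpace.Completion.isUniformInducing_coe _) s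

/-- The graph of the operator `D` on `Γ_c^∞(U, V)` in the Hilbert space `L²(U, V)`. -/
noncomputable def FirstOrderDiffOp.testGraph (D : FirstOrderDiffOp n F V) (U : Set N) :
    Submodule ℂ (SectionsL2 n F V U × SectionsL2 n F V U) :=
  LinearMap.range ((UniformSpace.Completion.toComplₗᵢ (𝕜 := ℂ)
    (E := TestSections n F V U)).toLinearMap.prod
      ((UniformSpace.Completion.toComplₗᵢ (𝕜 := ℂ)
        (E := TestSections n F V U)).toLinearMap ∘ₗ D.onTestSections U))

/-- The relation is closed in the pair `(s, D s)` and holds for sections supported in `U₀`; these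
are dense in the graph norm. Thus passing from `U₀` to the larger `U` does not shrink the adjoint.
-/
lemma inner_l2Inclusion_eq {U₀ U : Set N} (hdense : DenseInCompactSobolev n N U₀)
    (hU : U₀ ⊆ U) {D : FirstOrderDiffOp n F V} {y z : SectionsL2 n F V U₀}
    (h : ∀ q ∈ D.testGraph U₀, inner ℂ q.2 y = inner ℂ q.1 z) (s : TestSections n F V U) :
    inner ℂ (D.onTestSections U s : SectionsL2 n F V U) (l2Inclusion n F V hU y) =
      inner ℂ (s : SectionsL2 n F V U) (l2Inclusion n F V hU z) := by
  have hcl : IsClosed {p : TestSections n F V U × TestSections n F V U |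
      inner ℂ (p.2 : SectionsL2 n F V U) (l2Inclusion n F V hU y) =
        inner ℂ (p.1 : SectionsL2 n F V U) (l2Inclusion n F V hU z)} :=
    isClosed_eq
      (((UniformSpace.Completion.continuous_coe _).comp continuous_snd).inner continuous_const)
      (((UniformSpace.Completion.continuous_coe _).comp continuous_fst).inner continuous_const)
  have hsub := closure_minimal (s := Set.range fun t : TestSections n F V U₀ ↦
    (testInclusion n F V hU t, testInclusion n F V hU (D.onTestSections U₀ t))) (by
      rintro _ ⟨t, rfl⟩
      change inner ℂ _ _ = inner ℂ _ _
      rw [← l2Inclusion_coe, ← l2Inclusion_coe, LinearIsometry.inner_map_map,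
        LinearIsometry.inner_map_map]
      exact h _ ⟨t, rfl⟩) hcl
  refine hsub (a := (s, D.onTestSections U s)) (Metric.mem_closure_iff.2 fun ε hε ↦ ?_)
  obtain ⟨t, h1, h2⟩ := exists_testSections_approx hdense hU D s hε
  exact ⟨_, ⟨t, rfl⟩, by rw [Prod.dist_eq, dist_eq_norm, dist_eq_norm]; exact max_lt h1 h2⟩

variable {m : ℕ} {B : Type*} [TopologicalSpace B] [ChartedSpace (EuclideanSpace ℝ (Fin m)) B]
  [IsManifold (𝓡 m) ∞ B] {M : Set (N × B)}

/-- The product of a section over `M` with a smooth function on `B`. -/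
def mulTotalSection {g : B → ℂ} (hg : ContMDiff (𝓡 m) 𝓘(ℝ, ℂ) ∞ g)
    (ψ : totalSections n F V m B M) : totalSections n F V m B M :=
  have hsupp : sectionSupport (fun p : N × B ↦ g p.2 • ψ.1 p) ⊆ sectionSupport ψ.1 :=
    sectionSupport_mono fun p hp ↦ by simp [hp]
  ⟨fun p ↦ g p.2 • ψ.1 p,
    fun p ↦ SmoothAlongAt.smul (f := Prod.fst) (hg.contMDiffAt.comp p contMDiffAt_snd) (ψ.2.1 p),
    ψ.2.2.1.of_isClosed_subset isClosed_closure hsupp, hsupp.trans ψ.2.2.2⟩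

/-- On a slice `N × {b}` the function `g` is the constant `g(b)`. -/
lemma vertical_mulTotalSection (D : FirstOrderDiffOp n F V) {g : B → ℂ}
    (hg : ContMDiff (𝓡 m) 𝓘(ℝ, ℂ) ∞ g) (ψ : totalSections n F V m B M) :
    D.vertical M (mulTotalSection hg ψ) = mulTotalSection hg (D.vertical M ψ) := by
  refine Subtype.ext (funext fun p ↦ ?_)
  have h : sliceSection p.2 (mulTotalSection hg ψ) = g p.2 • sliceSection p.2 ψ := rfl
  change (D.toLinearMap (sliceSection p.2 (mulTotalSection hg ψ))).1 p.1 = _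
  rw [h, map_smul]
  rfl

/-- The section `(x, b) ↦ g(b) t(x)`. -/
def tensorSection {U₀ : Set N} (hU : ∀ b, U₀ ⊆ fibre M b) {g : B → ℂ}
    (hg : ContMDiff (𝓡 m) 𝓘(ℝ, ℂ) ∞ g) (hgc : HasCompactSupport g) (t : TestSections n F V U₀) :
    totalSections n F V m B M :=
  have hsupp : sectionSupport (fun p : N × B ↦ g p.2 • t.1 p.1) ⊆
      sectionSupport t.1 ×ˢ tsupport g :=
    closure_minimal (fun p hp ↦ ⟨subset_closure fun h ↦ hp (by simp [h]),
      subset_closure fun h ↦ hp (by simp [h])⟩) (isClosed_closure.prod (isClosed_tsupport g))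
  ⟨fun p ↦ g p.2 • t.1 p.1,
    fun p ↦ SmoothAlongAt.smul (f := Prod.fst) (hg.contMDiffAt.comp p contMDiffAt_snd)
      ((t.2.1 p.1).comp p contMDiffAt_fst),
    (t.2.2.1.prod hgc).of_isClosed_subset isClosed_closure hsupp,
    hsupp.trans fun p hp ↦ hU p.2 (t.2.2.2 hp.1)⟩

lemma vertical_tensorSection {U₀ : Set N} (hU : ∀ b, U₀ ⊆ fibre M b) {g : B → ℂ}
    (hg : ContMDiff (𝓡 m) 𝓘(ℝ, ℂ) ∞ g) (hgc : HasCompactSupport g) (t : TestSections n F V U₀)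
    (D : FirstOrderDiffOp n F V) : D.vertical M (tensorSection hU hg hgc t) =
      tensorSection hU hg hgc (D.onTestSections U₀ t) := by
  refine Subtype.ext (funext fun p ↦ ?_)
  have h : sliceSection p.2 (tensorSection hU hg hgc t) =
    g p.2 • (⟨t.1, t.2.1⟩ : SmoothSections n F V) := rfl
  change (D.toLinearMap (sliceSection p.2 (tensorSection hU hg hgc t))).1 p.1 = _
  rw [h, map_smul]
  rfl

lemma sliceL2_tensorSection {U₀ : Set N} (hU : ∀ b, U₀ ⊆ fibre M b) {g : B → ℂ}
    (hg : ContMDiff (𝓡 m) 𝓘(ℝ, ℂ) ∞ g) (hgc : HasCompactSupport g) (t : TestSections n F V U₀)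
    (b : B) : sliceL2 M b (tensorSection hU hg hgc t) =
      g b • l2Inclusion n F V (hU b) (t : SectionsL2 n F V U₀) := by
  have h : slice M b (tensorSection hU hg hgc t) = g b • testInclusion n F V (hU b) t := rfl
  rw [l2Inclusion_coe, sliceL2, LinearMap.comp_apply, h, map_smul]
  rfl

lemma sliceL2_mulTotalSection {g : B → ℂ} (hg : ContMDiff (𝓡 m) 𝓘(ℝ, ℂ) ∞ g)
    (ψ : totalSections n F V m B M) (b : B) :
    sliceL2 M b (mulTotalSection hg ψ) = g b • sliceL2 M b ψ := by
  have h : slice M b (mulTotalSection hg ψ) = g b • slice M b ψ := rfl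
  rw [sliceL2, LinearMap.comp_apply, h, map_smul]
  rfl

/-- The bounded section `b ↦ g(b) w` of the field of Hilbert spaces `b ↦ L²(M_b, V)`. -/
noncomputable def fieldTensor {U₀ : Set N} (hU : ∀ b, U₀ ⊆ fibre M b) (g : C₀(B, ℂ)) :
    SectionsL2 n F V U₀ →L[ℂ] lp (fun b ↦ SectionsL2 n F V (fibre M b)) ⊤ :=
  have hle (w : SectionsL2 n F V U₀) (b : B) : ‖g b • l2Inclusion n F V (hU b) w‖ ≤ ‖g‖ * ‖w‖ := by
    rw [norm_smul, LinearIsometry.norm_map]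
    gcongr
    exact zeroAtInfty_norm_apply_le g b
  LinearMap.mkContinuous
    { toFun := fun w ↦ ⟨fun b ↦ g b • l2Inclusion n F V (hU b) w,
        memℓp_infty ⟨‖g‖ * ‖w‖, by rintro _ ⟨b, rfl⟩; exact hle w b⟩⟩
      map_add' := fun v w ↦ by
        ext b : 2
        change g b • l2Inclusion n F V (hU b) (v + w) =
          g b • l2Inclusion n F V (hU b) v + g b • l2Inclusion n F V (hU b) w
        rw [map_add, smul_add]
      map_smul' := fun c w ↦ by
        ext b : 2
        change g b • l2Inclusion n F V (hU b) (c • w) = c • (g b • l2Inclusion n F V (hU b) w)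
        rw [map_smul, smul_comm] }
    ‖g‖ fun w ↦ lp.norm_le_of_forall_le (by positivity) (hle w)

/-- A compactly supported smooth function, as an element of `C₀(B)`. -/
def smoothToC0 {g : B → ℂ} (hg : ContMDiff (𝓡 m) 𝓘(ℝ, ℂ) ∞ g) (hgc : HasCompactSupport g) :
    C₀(B, ℂ) :=
  ⟨⟨g, hg.continuous⟩, hgc.is_zero_at_infty⟩

/-- For a test section `t` the field is the genuine smooth section `g ⊗ t` over `M`; general `w`
follows by continuity, the module being closed. -/
lemma fieldTensor_mem {U₀ : Set N} (hU : ∀ b, U₀ ⊆ fibre M b) {g : B → ℂ}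
    (hg : ContMDiff (𝓡 m) 𝓘(ℝ, ℂ) ∞ g) (hgc : HasCompactSupport g) (w : SectionsL2 n F V U₀) :
    fieldTensor hU (smoothToC0 hg hgc) w ∈ FieldModule n F V m B M := by
  induction w using UniformSpace.Completion.induction_on with
  | hp => exact (Submodule.isClosed_topologicalClosure _).preimage (ContinuousLinearMap.continuous _)
  | ih t =>
    refine Submodule.le_topologicalClosure _ ⟨tensorSection hU hg hgc t, ?_⟩
    ext b : 2
    exact sliceL2_tensorSection hU hg hgc t b

/-- The element `b ↦ g(b) w` of the Hilbert module `Γ₀(B, E_•)`. -/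
noncomputable def moduleTensor {U₀ : Set N} (hU : ∀ b, U₀ ⊆ fibre M b) {g : B → ℂ}
    (hg : ContMDiff (𝓡 m) 𝓘(ℝ, ℂ) ∞ g) (hgc : HasCompactSupport g) :
    SectionsL2 n F V U₀ →L[ℂ] FieldModule n F V m B M :=
  (fieldTensor hU (smoothToC0 hg hgc)).codRestrict _ (fieldTensor_mem hU hg hgc)

lemma moduleTensor_apply {U₀ : Set N} (hU : ∀ b, U₀ ⊆ fibre M b) {g : B → ℂ}
    (hg : ContMDiff (𝓡 m) 𝓘(ℝ, ℂ) ∞ g) (hgc : HasCompactSupport g) (w : SectionsL2 n F V U₀)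
    (b : B) : (moduleTensor hU hg hgc w).1 b = g b • l2Inclusion n F V (hU b) w := rfl

lemma moduleTensor_coe {U₀ : Set N} (hU : ∀ b, U₀ ⊆ fibre M b) {g : B → ℂ}
    (hg : ContMDiff (𝓡 m) 𝓘(ℝ, ℂ) ∞ g) (hgc : HasCompactSupport g) (t : TestSections n F V U₀) :
    moduleTensor hU hg hgc (t : SectionsL2 n F V U₀) =
      totalToModule M (tensorSection hU hg hgc t) := by
  refine Subtype.ext (lp.ext (funext fun b ↦ ?_))
  exact (sliceL2_tensorSection hU hg hgc t b).symm

lemma dist_fieldModule_le {s t : FieldModule n F V m B M} {ε : ℝ} (hε : 0 ≤ ε)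
    (h : ∀ b, ‖s.1 b - t.1 b‖ ≤ ε) : dist s t ≤ ε := by
  rw [dist_eq_norm]
  exact lp.norm_le_of_forall_le hε h

lemma denseRange_totalToModule :
    DenseRange (totalToModule M : totalSections n F V m B M →ₗ[ℂ] FieldModule n F V m B M) := by
  intro s
  refine Metric.mem_closure_iff.2 fun ε hε ↦ ?_
  obtain ⟨_, ⟨ψ, rfl⟩, h⟩ := Metric.mem_closure_iff.1 (show s.1 ∈ closure _ from s.2) ε hε
  exact ⟨_, ⟨ψ, rfl⟩, h⟩

end Module

/-! ### The closure of the vertical operator and its regularity -/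

section VerticalOperator

variable {n : ℕ} {N : Type*} [TopologicalSpace N] [ChartedSpace (EuclideanSpace ℝ (Fin n)) N]
  [T2Space N] [SigmaCompactSpace N] [IsManifold (𝓡 n) ∞ N] [MeasurableSpace N] [BorelSpace N]
  [RiemannianBundle (fun x : N ↦ TangentSpace (𝓡 n) x)]
  [IsContMDiffRiemannianBundle (𝓡 n) ∞ (EuclideanSpace ℝ (Fin n))
    (fun x : N ↦ TangentSpace (𝓡 n) x)]
  {F : Type*} [NormedAddCommGroup F] [NormedSpace ℂ F]
  {V : N → Type*} [TopologicalSpace (TotalSpace F V)] [∀ x, NormedAddCommGroup (V x)]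
  [∀ x, InnerProductSpace ℂ (V x)] [FiberBundle F V] [VectorBundle ℂ F V] [VectorBundle ℝ F V]
  [IsSmoothHermitianBundle n F V]
  {m : ℕ} {B : Type*} [TopologicalSpace B] [ChartedSpace (EuclideanSpace ℝ (Fin m)) B]
  [IsManifold (𝓡 m) ∞ B] {M : Set (N × B)}

variable (M) in
lemma FirstOrderDiffOp.graph_verticalOperator (D : FirstOrderDiffOp n F V) :
    (D.verticalOperator (m := m) M).graph =
      LinearMap.range ((totalToModule M).prod (totalToModule M ∘ₗ D.vertical M)) := by
  have h (ψ : totalSections n F V m B M) : D.verticalOperator M ⟨totalToModule M ψ, ψ, rfl⟩ =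
      totalToModule M (D.vertical M ψ) := by
    refine congrArg (fun φ ↦ totalToModule M (D.vertical M φ)) ?_
    exact (LinearEquiv.ofInjective (totalToModule M) (totalToModule_injective M)).symm_apply_apply ψ
  ext p
  rw [LinearPMap.mem_graph_iff]
  constructor
  · rintro ⟨⟨_, ψ, rfl⟩, h1, h2⟩
    exact ⟨ψ, Prod.ext h1 ((h ψ).symm.trans h2)⟩
  · rintro ⟨ψ, rfl⟩
    exact ⟨⟨_, ψ, rfl⟩, rfl, h ψ⟩

lemma continuous_fieldModule_apply (b : B) :
    Continuous fun s : FieldModule n F V m B M ↦ s.1 b := by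
  refine continuous_iff_continuousAt.2 fun s ↦ Metric.tendsto_nhds.2 fun ε hε ↦ ?_
  filter_upwards [Metric.ball_mem_nhds s hε] with t ht
  rw [Metric.mem_ball, dist_eq_norm] at ht
  rw [dist_eq_norm]
  exact (lp.norm_apply_le_norm ENNReal.top_ne_zero (t.1 - s.1) b).trans_lt ht

lemma sliceL2_vertical (D : FirstOrderDiffOp n F V) (ψ : totalSections n F V m B M) (b : B) :
    sliceL2 M b (D.vertical M ψ) =
      (D.onTestSections (fibre M b) (slice M b ψ) : SectionsL2 n F V (fibre M b)) := rfl

/-- Adjoint relations in a single fibre need only be checked on smooth sections: evaluation at `b`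
is continuous, so they persist on the closed graph. -/
lemma inner_eq_of_mem_closure_graph {D : FirstOrderDiffOp n F V} {b : B}
    {y z : SectionsL2 n F V (fibre M b)}
    (h : ∀ ψ : totalSections n F V m B M,
      inner ℂ (sliceL2 M b (D.vertical M ψ)) y = inner ℂ (sliceL2 M b ψ) z)
    {p : FieldModule n F V m B M × FieldModule n F V m B M}
    (hp : p ∈ (D.verticalOperator M).graph.topologicalClosure) :
    inner ℂ (p.2.1 b) y = inner ℂ (p.1.1 b) z := by
  have hcl : IsClosed {p : FieldModule n F V m B M × FieldModule n F V m B M |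
      inner ℂ (p.2.1 b) y = inner ℂ (p.1.1 b) z} :=
    isClosed_eq (((continuous_fieldModule_apply b).comp continuous_snd).inner continuous_const)
      (((continuous_fieldModule_apply b).comp continuous_fst).inner continuous_const)
  rw [D.graph_verticalOperator] at hp
  exact closure_minimal (by rintro _ ⟨ψ, rfl⟩; exact h ψ) hcl hp

lemma FirstOrderDiffOp.IsSymmetric.inner_sliceL2 {D : FirstOrderDiffOp n F V} (hD : D.IsSymmetric)
    (ψ φ : totalSections n F V m B M) (b : B) :
    inner ℂ (sliceL2 M b (D.vertical M ψ)) (sliceL2 M b φ) =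
      inner ℂ (sliceL2 M b ψ) (sliceL2 M b (D.vertical M φ)) := by
  rw [sliceL2_vertical, sliceL2_vertical]
  exact (UniformSpace.Completion.inner_coe _ _).trans
    ((hD.inner_onTestSections _ _).trans (UniformSpace.Completion.inner_coe _ _).symm)

/-- If `(0, y)` lies in the closed graph, symmetry gives `⟨y, ψ⟩ = ⟨0, 𝓓ψ⟩ = 0` for all smooth `ψ`,
and these are dense. -/
lemma FirstOrderDiffOp.IsSymmetric.isClosable_verticalOperator {D : FirstOrderDiffOp n F V}
    (hD : D.IsSymmetric) : (D.verticalOperator (m := m) M).IsClosable := by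
  refine ⟨_, (Submodule.toLinearPMap_graph_eq _ ?_).symm⟩
  rintro ⟨x, y⟩ hp (rfl : x = 0)
  have h (ψ : totalSections n F V m B M) (b : B) : inner ℂ (y.1 b) (sliceL2 M b ψ) = 0 := by
    refine (inner_eq_of_mem_closure_graph (fun φ ↦ hD.inner_sliceL2 φ ψ b) hp).trans ?_
    exact inner_zero_left _
  refine Subtype.ext (lp.ext (funext fun b ↦ ?_))
  have hcl : IsClosed {s : FieldModule n F V m B M | inner ℂ (y.1 b) (s.1 b) = 0} :=
    isClosed_eq (continuous_const.inner (continuous_fieldModule_apply b)) continuous_const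
  exact inner_self_eq_zero.1 (closure_minimal (by rintro _ ⟨ψ, rfl⟩; exact h ψ b) hcl
    (denseRange_totalToModule y))

/-- `𝓓 (g ⊗ t) = g ⊗ D t` on test sections, and `w ↦ g ⊗ w` is continuous. -/
lemma moduleTensor_mem_closure_graph {U₀ : Set N} (hU : ∀ b, U₀ ⊆ fibre M b) {g : B → ℂ}
    (hg : ContMDiff (𝓡 m) 𝓘(ℝ, ℂ) ∞ g) (hgc : HasCompactSupport g) (D : FirstOrderDiffOp n F V)
    {p : SectionsL2 n F V U₀ × SectionsL2 n F V U₀} (hp : p ∈ (D.testGraph U₀).topologicalClosure) :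
    (moduleTensor hU hg hgc p.1, moduleTensor hU hg hgc p.2) ∈
      (D.verticalOperator M).graph.topologicalClosure := by
  have hcl := (Submodule.isClosed_topologicalClosure (D.verticalOperator (m := m) M).graph).preimage
    (((moduleTensor hU hg hgc).continuous.comp continuous_fst).prodMk
      ((moduleTensor hU hg hgc).continuous.comp (continuous_snd (X := SectionsL2 n F V U₀))))
  refine closure_minimal ?_ hcl hp
  rintro _ ⟨t, rfl⟩
  refine Submodule.le_topologicalClosure _ ?_
  rw [D.graph_verticalOperator]
  refine ⟨tensorSection hU hg hgc t, Prod.ext (moduleTensor_coe hU hg hgc t).symm ?_⟩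
  exact (congrArg _ (vertical_tensorSection hU hg hgc t D)).trans
    (moduleTensor_coe hU hg hgc (D.onTestSections U₀ t)).symm

/-- The range of `1 + T⋆T` for the closure `T` of the vertical operator, with the adjoint relation
stated fibrewise. -/
def FirstOrderDiffOp.oneAddRange (D : FirstOrderDiffOp n F V) :
    Submodule ℂ (FieldModule n F V m B M) where
  carrier := {w | ∃ p ∈ (D.verticalOperator (m := m) M).graph.topologicalClosure,
    ∃ z : FieldModule n F V m B M, (∀ q ∈ (D.verticalOperator (m := m) M).graph.topologicalClosure, ∀ b,
      inner ℂ (q.2.1 b) (p.2.1 b) = inner ℂ (q.1.1 b) (z.1 b)) ∧ w = p.1 + z}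
  add_mem' := by
    rintro _ _ ⟨p, hp, z, hz, rfl⟩ ⟨p', hp', z', hz', rfl⟩
    refine ⟨p + p', add_mem hp hp', z + z', fun q hq b ↦ ?_, by rw [Prod.fst_add]; abel⟩
    exact (inner_add_right _ _ _).trans ((congrArg₂ _ (hz q hq b) (hz' q hq b)).trans
      (inner_add_right _ _ _).symm)
  zero_mem' := ⟨0, zero_mem _, 0, fun q _ b ↦
    (inner_zero_right _).trans (inner_zero_right _).symm, by simp⟩
  smul_mem' := by
    rintro c _ ⟨p, hp, z, hz, rfl⟩
    refine ⟨c • p, Submodule.smul_mem _ c hp, c • z, fun q hq b ↦ ?_, by simp⟩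
    exact (inner_smul_right _ _ _).trans ((congrArg _ (hz q hq b)).trans
      (inner_smul_right _ _ _).symm)

/-- If `p` solves the problem for `w` in `L²(U₀)`, then `g ⊗ p.1` solves it for `g ⊗ w`, with `g ⊗
(w - p.1)` as the value of `T⋆T`. The relation must hold against all sections over `M`, not only
those supported over `U₀`; `inner_l2Inclusion_eq` supplies this fibre by fibre. -/
lemma moduleTensor_mem_oneAddRange {U₀ : Set N} (hdense : DenseInCompactSobolev n N U₀)
    (hU : ∀ b, U₀ ⊆ fibre M b) {g : B → ℂ}
    (hg : ContMDiff (𝓡 m) 𝓘(ℝ, ℂ) ∞ g) (hgc : HasCompactSupport g) (D : FirstOrderDiffOp n F V)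
    (w : SectionsL2 n F V U₀) : moduleTensor hU hg hgc w ∈ D.oneAddRange (M := M) := by
  obtain ⟨p, hp, hpw⟩ := exists_mem_topologicalClosure_inner_eq (D.testGraph U₀) w
  refine show ∃ _, _ from ⟨_, moduleTensor_mem_closure_graph hU hg hgc D hp,
    moduleTensor hU hg hgc (w - p.1), fun q hq b ↦ ?_, by rw [map_sub]; abel⟩
  refine inner_eq_of_mem_closure_graph (fun ψ ↦ ?_) hq
  rw [moduleTensor_apply, moduleTensor_apply, inner_smul_right, inner_smul_right, sliceL2_vertical]
  congr 1
  exact inner_l2Inclusion_eq hdense (hU b)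
    (fun q hq ↦ hpw q (Submodule.le_topologicalClosure _ hq)) (slice M b ψ)

variable [SigmaCompactSpace B] [T2Space B]

/-- Approximate `ψ(·, b₀)` by a section `t` supported in `U₀`, which makes sense in every fibre. The
error stays small near `b₀` because fibre norms of smooth sections over `M` vary continuously. The
compact `K` will make partition functions supported in `O` compactly supported. -/
lemma exists_nhds_norm_slice_sub_lt {U₀ : Set N} (hdense : DenseInCompactSobolev n N U₀)
    (hU : ∀ b, U₀ ⊆ fibre M b) (D : FirstOrderDiffOp n F V) (ψ : totalSections n F V m B M)
    {ε : ℝ} (hε : 0 < ε) (b₀ : B) : ∃ (O K : Set B) (t : TestSections n F V U₀), IsOpen O ∧ b₀ ∈ O ∧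
      O ⊆ K ∧ IsCompact K ∧ ∀ b ∈ O,
        ‖sliceL2 M b ψ - l2Inclusion n F V (hU b) (t : SectionsL2 n F V U₀)‖ < ε := by
  have : LocallyCompactSpace B := Manifold.locallyCompact_of_finiteDimensional (𝓡 m)
  obtain ⟨t, ht, -⟩ := exists_testSections_approx hdense (hU b₀) D (slice M b₀ ψ) hε
  obtain ⟨K, hK, hbK⟩ := exists_compact_mem_nhds b₀
  obtain ⟨g, hg1, hg0, -⟩ := exists_contMDiffMap_one_nhds_of_subset_interior (n := ⊤) (𝓡 m)
    (isClosed_singleton (x := b₀)) (singleton_subset_iff.2 (mem_interior_iff_mem_nhds.2 hbK))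
  have hg : ContMDiff (𝓡 m) 𝓘(ℝ, ℂ) ∞ (fun x ↦ (g x : ℂ)) :=
    Complex.ofRealCLM.contDiff.contMDiff.comp g.contMDiff
  have hgc : HasCompactSupport (fun x ↦ (g x : ℂ)) :=
    HasCompactSupport.intro hK fun x hx ↦ by simp [hg0 x hx]
  -- The cutoff `g`, equal to 1 near `b₀`, turns the constant section `t` into a compactly supported
  -- one over `M`, so that continuity of the norm applies to the difference.
  set φ := ψ - tensorSection hU hg hgc t with hφ
  obtain ⟨f, hf⟩ := exists_inner_totalSections φ φ
  have hnorm (b : B) : ‖sliceL2 M b φ‖ = √(f b).re := by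
    rw [hf]
    exact norm_eq_sqrt_re_inner (𝕜 := ℂ) _
  have hsl (b : B) : sliceL2 M b φ =
      sliceL2 M b ψ - (g b : ℂ) • l2Inclusion n F V (hU b) (t : SectionsL2 n F V U₀) := by
    rw [hφ, map_sub, sliceL2_tensorSection]
  have hc : Continuous fun b ↦ ‖sliceL2 M b φ‖ := by
    simp only [hnorm]
    exact (Complex.continuous_re.comp f.continuous).sqrt
  rw [nhdsSet_singleton] at hg1
  have h0 : ‖sliceL2 M b₀ φ‖ < ε := by
    rw [hsl, hg1.self_of_nhds, Complex.ofReal_one, one_smul, l2Inclusion_coe]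
    rw [← UniformSpace.Completion.norm_coe, UniformSpace.Completion.coe_sub] at ht
    exact ht
  obtain ⟨O, hOs, hO, hbO⟩ := mem_nhds_iff.1 (Filter.inter_mem hbK
    (hg1.and (hc.continuousAt.eventually_lt continuousAt_const h0)))
  refine ⟨O, K, t, hO, hbO, fun b hb ↦ (hOs hb).1, hK, fun b hb ↦ ?_⟩
  obtain ⟨-, h1, h2⟩ := hOs hb
  rwa [hsl, h1, Complex.ofReal_one, one_smul] at h2

/-- A smooth section `ψ` is approximated uniformly in `b` by a finite sum `∑ fᵢ ⊗ tᵢ`, with `fᵢ` a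
partition of unity on the compact projection of its support to `B`. Each summand lies in the range.
-/
lemma dense_oneAddRange {U₀ : Set N} (hdense : DenseInCompactSobolev n N U₀)
    (hU : ∀ b, U₀ ⊆ fibre M b) (D : FirstOrderDiffOp n F V) :
    Dense (D.oneAddRange (m := m) (B := B) (M := M) : Set (FieldModule n F V m B M)) := by
  suffices h : Set.range (totalToModule M : totalSections n F V m B M →ₗ[ℂ] _) ⊆
      closure (D.oneAddRange (m := m) (B := B) (M := M) : Set (FieldModule n F V m B M)) from
    fun s ↦ closure_minimal h isClosed_closure (denseRange_totalToModule s)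
  rintro _ ⟨ψ, rfl⟩
  refine Metric.mem_closure_iff.2 fun ε hε ↦ ?_
  choose O K t hO hbO hOK hK ht using
    exists_nhds_norm_slice_sub_lt hdense hU D ψ (half_pos hε)
  have hL : IsCompact (Prod.snd '' sectionSupport ψ.1) := ψ.2.2.1.image continuous_snd
  obtain ⟨S, -, hS⟩ := hL.elim_nhds_subcover O fun b _ ↦ (hO b).mem_nhds (hbO b)
  obtain ⟨f, hf⟩ := SmoothPartitionOfUnity.exists_isSubordinate (𝓡 m) hL.isClosed
    (fun i : S ↦ O i) (fun i ↦ hO i) (by simpa [iUnion_subtype] using hS)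
  have hsum (b : B) : ∑ i, f i b ≤ 1 := by
    rw [← finsum_eq_sum_of_fintype]
    exact f.sum_le_one b
  have hg (i : S) : ContMDiff (𝓡 m) 𝓘(ℝ, ℂ) ∞ (fun b ↦ (f i b : ℂ)) :=
    Complex.ofRealCLM.contDiff.contMDiff.comp (f i).contMDiff
  have hgc (i : S) : HasCompactSupport (fun b ↦ (f i b : ℂ)) :=
    HasCompactSupport.intro (hK i) fun b hb ↦ by
      rw [image_eq_zero_of_notMem_tsupport fun h ↦ hb (hOK i (hf i h)), Complex.ofReal_zero]
  refine ⟨∑ i, moduleTensor hU (hg i) (hgc i) (t i : SectionsL2 n F V U₀), sum_mem fun i _ ↦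
    moduleTensor_mem_oneAddRange hdense hU (hg i) (hgc i) D _, ?_⟩
  -- Fibrewise bounds pass to the supremum only as `≤`, hence the reserve `ε / 2`.
  refine (dist_fieldModule_le (half_pos hε).le fun b ↦ ?_).trans_lt (half_lt_self hε)
  have h1 : (∑ i, moduleTensor (M := M) hU (hg i) (hgc i) (t i : SectionsL2 n F V U₀)).1 b =
      ∑ i, (f i b : ℂ) • l2Inclusion n F V (hU b) (t i : SectionsL2 n F V U₀) := by
    rw [Submodule.coe_sum, lp.coeFn_sum, Finset.sum_apply]
    rfl
  -- Over the projection of the support the `fᵢ` sum to 1; elsewhere `ψ(·, b) = 0`.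
  have h2 : (totalToModule M ψ).1 b = ∑ i, (f i b : ℂ) • sliceL2 M b ψ := by
    change sliceL2 M b ψ = _
    rw [← Finset.sum_smul, ← Complex.ofReal_sum]
    by_cases hb : b ∈ Prod.snd '' sectionSupport ψ.1
    · rw [← finsum_eq_sum_of_fintype, f.sum_eq_one hb, Complex.ofReal_one, one_smul]
    · have h3 : slice M b ψ = 0 := Subtype.ext (funext fun x ↦
        eq_zero_of_notMem_sectionSupport (s := ψ.1) (x := (x, b)) fun h ↦ hb ⟨(x, b), h, rfl⟩)
      rw [sliceL2, LinearMap.comp_apply, h3, map_zero, smul_zero]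
  rw [h1, h2, ← Finset.sum_sub_distrib]
  calc _ ≤ ∑ i, f i b * (ε / 2) := by
        refine norm_sum_le_of_le _ fun i _ ↦ ?_
        rw [← smul_sub, norm_smul, Complex.norm_real, Real.norm_eq_abs, abs_of_nonneg (f.nonneg i b)]
        by_cases hb : b ∈ tsupport (f i)
        · exact mul_le_mul_of_nonneg_left (ht i b (hf i hb)).le (f.nonneg i b)
        · rw [image_eq_zero_of_notMem_tsupport hb, zero_mul, zero_mul]
    _ ≤ 1 * (ε / 2) := by
        rw [← Finset.sum_mul]
        exact mul_le_mul_of_nonneg_right (hsum b) (half_pos hε).le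
    _ = ε / 2 := one_mul _

lemma continuous_fieldModule_smul (a : C₀(B, ℂ)) :
    Continuous fun s : FieldModule n F V m B M ↦ a • s := by
  refine (LipschitzWith.of_dist_le_mul (K := ‖a‖₊) fun s t ↦ ?_).continuous
  refine dist_fieldModule_le (by positivity) fun b ↦ ?_
  rw [fieldModule_smul_apply, fieldModule_smul_apply, ← smul_sub, norm_smul, dist_eq_norm]
  exact mul_le_mul (zeroAtInfty_norm_apply_le a b)
    (lp.norm_apply_le_norm ENNReal.top_ne_zero (s.1 - t.1) b) (norm_nonneg _) (norm_nonneg _)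

/-- A merely continuous `a` need not preserve smooth sections. It is approximated uniformly by a
smooth `g`, for which `𝓓 (g ψ) = g 𝓓 ψ`. -/
lemma smul_mem_closure_graph (D : FirstOrderDiffOp n F V) (a : C₀(B, ℂ))
    {p : FieldModule n F V m B M × FieldModule n F V m B M}
    (hp : p ∈ (D.verticalOperator M).graph.topologicalClosure) :
    (a • p.1, a • p.2) ∈ (D.verticalOperator M).graph.topologicalClosure := by
  have hcl := (Submodule.isClosed_topologicalClosure (D.verticalOperator (m := m) M).graph).preimage
    (((continuous_fieldModule_smul a).comp continuous_fst).prodMk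
      ((continuous_fieldModule_smul a).comp (continuous_snd (X := FieldModule n F V m B M))))
  rw [D.graph_verticalOperator] at hp
  refine closure_minimal ?_ hcl hp
  rintro _ ⟨ψ, rfl⟩
  refine Metric.mem_closure_iff.2 fun ε hε ↦ ?_
  obtain ⟨C, hC0, hC⟩ := exists_norm_sliceL2_le ψ
  obtain ⟨C', hC0', hC'⟩ := exists_norm_sliceL2_le (D.vertical M ψ)
  obtain ⟨g, hg, -⟩ := a.continuous.exists_contMDiff_approx (𝓡 m) ⊤
    -- The constant `C + C' + 1` is positive and dominates the fibre norms of both `ψ` and `𝓓 ψ`.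
    (continuous_const (y := ε / 2 / (C + C' + 1))) (fun _ ↦ by positivity)
  have key (φ : totalSections n F V m B M) (hφ : ∀ b, ‖sliceL2 M b φ‖ ≤ C + C' + 1) :
      dist (a • totalToModule M φ) (totalToModule M (mulTotalSection g.contMDiff φ)) < ε := by
    refine (dist_fieldModule_le (half_pos hε).le fun b ↦ ?_).trans_lt (half_lt_self hε)
    change ‖a b • sliceL2 M b φ - sliceL2 M b (mulTotalSection g.contMDiff φ)‖ ≤ _
    rw [sliceL2_mulTotalSection, ← sub_smul, norm_smul, ← dist_eq_norm, dist_comm]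
    calc dist (g b) (a b) * ‖sliceL2 M b φ‖ ≤ ε / 2 / (C + C' + 1) * (C + C' + 1) :=
          mul_le_mul (hg b).le (hφ b) (norm_nonneg _) (by positivity)
      _ = ε / 2 := by field_simp
  refine ⟨(totalToModule M (mulTotalSection g.contMDiff ψ),
    totalToModule M (D.vertical M (mulTotalSection g.contMDiff ψ))), ?_, ?_⟩
  · rw [D.graph_verticalOperator]
    exact ⟨_, rfl⟩
  · rw [vertical_mulTotalSection]
    exact max_lt (key ψ fun b ↦ (hC b).trans (by linarith))
      (key (D.vertical M ψ) fun b ↦ (hC' b).trans (by linarith))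

/-- The closure of the vertical operator is regular if all fibres of `M` contain an open set `U₀`
such that `C_c^∞(U₀)` is dense in `H¹_c(N)`. -/
lemma FirstOrderDiffOp.IsSymmetric.isRegularOperator_closure {D : FirstOrderDiffOp n F V}
    (hD : D.IsSymmetric) {U₀ : Set N} (hdense : DenseInCompactSobolev n N U₀)
    (hU : ∀ b, U₀ ⊆ fibre M b) :
    IsRegularOperator C₀(B, ℂ) (D.verticalOperator (m := m) M).closure := by
  set T := (D.verticalOperator (m := m) M).closure
  have hcl : (D.verticalOperator (m := m) M).IsClosable := hD.isClosable_verticalOperator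
  have hgraph (p) : p ∈ (D.verticalOperator (m := m) M).graph.topologicalClosure ↔
      p ∈ T.graph := by rw [hcl.graph_closure_eq_closure_graph]
  have hT (x : T.domain) : ((x : FieldModule n F V m B M), T x) ∈
      (D.verticalOperator (m := m) M).graph.topologicalClosure :=
    (hgraph _).2 (T.mem_graph x)
  refine ⟨hcl.closure_isClosed, ?_, fun a x ↦ ?_, ?_, ?_⟩
  · exact denseRange_totalToModule.mono (LinearPMap.le_closure _).1
  · obtain ⟨y, h1, h2⟩ := (LinearPMap.mem_graph_iff _).1
      ((hgraph _).1 (smul_mem_closure_graph D a (hT x)))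
    have h1' : (y : FieldModule n F V m B M) = a • (x : FieldModule n F V m B M) := h1
    exact ⟨h1' ▸ y.2, (congrArg T (Subtype.ext h1'.symm)).trans h2⟩
  -- By symmetry every smooth section `φ` lies in the domain of the adjoint, with image `𝓓 φ`.
  · refine denseRange_totalToModule.mono ?_
    rintro _ ⟨φ, rfl⟩
    refine ⟨totalToModule M (D.vertical M φ), fun x ↦ ?_⟩
    ext b
    rw [fieldModule_inner_apply, fieldModule_inner_apply]
    change inner ℂ ((T x).1 b) (sliceL2 M b φ) =
      inner ℂ ((x : FieldModule n F V m B M).1 b) (sliceL2 M b (D.vertical M φ))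
    exact inner_eq_of_mem_closure_graph (p := (x, T x)) (fun ψ ↦ hD.inner_sliceL2 ψ φ b) (hT x)
  -- The `C₀(B)`-valued inner product is computed pointwise, so the fibrewise relation in
  -- `oneAddRange` is the required one.
  · refine (dense_oneAddRange hdense hU D).mono ?_
    rintro _ ⟨p, hp, z, hz, rfl⟩
    obtain ⟨x, h1, h2⟩ := (LinearPMap.mem_graph_iff _).1 ((hgraph _).1 hp)
    refine ⟨x, z, fun x' ↦ ?_, by rw [h1]⟩
    ext b
    rw [fieldModule_inner_apply, fieldModule_inner_apply, h2]
    exact hz _ (hT x') b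

end VerticalOperator

theorem mainTheorem8
    -- the Riemannian manifold `N`
    {n : ℕ} {N : Type*} [TopologicalSpace N] [ChartedSpace (EuclideanSpace ℝ (Fin n)) N]
    [T2Space N] [SigmaCompactSpace N] [IsManifold (𝓡 n) ∞ N] [MeasurableSpace N] [BorelSpace N]
    [RiemannianBundle (fun x : N ↦ TangentSpace (𝓡 n) x)]
    [IsContMDiffRiemannianBundle (𝓡 n) ∞ (EuclideanSpace ℝ (Fin n))
      (fun x : N ↦ TangentSpace (𝓡 n) x)]
    -- the smooth hermitian vector bundle `V` over `N`
    {F : Type*} [NormedAddCommGroup F] [NormedSpace ℂ F] [FiniteDimensional ℂ F]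
    {V : N → Type*} [TopologicalSpace (TotalSpace F V)] [∀ x, NormedAddCommGroup (V x)]
    [∀ x, InnerProductSpace ℂ (V x)] [FiberBundle F V] [VectorBundle ℂ F V] [VectorBundle ℝ F V]
    [ContMDiffVectorBundle ∞ F V (𝓡 n)] [IsSmoothHermitianBundle n F V]
    -- the manifold `B`
    {m : ℕ} {B : Type*} [TopologicalSpace B] [ChartedSpace (EuclideanSpace ℝ (Fin m)) B]
    [T2Space B] [SigmaCompactSpace B] [IsManifold (𝓡 m) ∞ B]
    (D : FirstOrderDiffOp n F V) (hell : D.IsElliptic) (hsymm : D.IsSymmetric)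
    (CN : Set N) (hCN : IsCompact CN) (CB : Set B) (hCB : IsClosed CB)
    (hdense : DenseInCompactSobolev n N CNᶜ) :
    IsRegularOperator C₀(B, ℂ)
      (D.verticalOperator (m := m) (removedProduct CN CB)).closure := by
  -- `U₀ = N ∖ C_N` lies in every fibre because `(N ∖ C_N) × B ⊆ M`.
  exact hsymm.isRegularOperator_closure hdense fun _ _ hx ↦ Or.inl ⟨hx, mem_univ _⟩
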